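/- Let $k$ be a field of characteristic $0$ and let $\mathcal T$ be a dg category over $k$: a class of objects, cochain complexes of $k$-vector spaces $\mathcal T(x,y)$ indexed by $\mathbb Z$ (differential of degree $+1$), units, and compositions $\mathcal T(y,z)\otimes\mathcal T(x,y)\to\mathcal T(x,z)$ that are maps of complexes, subject to the associativity and unit laws. A (right) $\mathcal T$-module is a dg functor $\mathcal T^{op}\to Ch(k)$. A map of modules is a weak equivalence if it is a pointwise quasi-isomorphism, and two modules are weakly equivalent if they are connected by a zigzag of weak equivalences. The suspension is the pointwise shift $(\Sigma M)(x)=M(x)[1]$, and the homotopy cofiber of a map of modules is its pointwise mapping cone. The category $\mathcal T^{\text{pre-tr}}$ is the following dg category. Its objects are pairs $(\bigoplus_{i=1}^n C_i[r_i],q)$ with $n\ge 0$, $C_i\in\mathcal T$, $r_i\in\mathbb Z$ and $q=(q_{ij})$, where $q_{ij}\in\mathcal T(C_i,C_j)[r_j-r_i]$ has degree $1$ and $d'q+q^2=0$. A morphism of degree $l$ from $(\bigoplus C_i[r_i],q)$ to $(\bigoplus C'_j[r'_j],q')$ is a matrix $f=(f_{ij})$ with $f_{ij}$ of degree $l$ in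 $\mathcal T(C_i,C'_j)[r'_j-r_i]$, i.e. in $\mathcal T(C_i,C'_j)^{l+r'_j-r_i}$. Composition is matrix multiplication, and $df=d'f+q'f-(-1)^l fq$, where $(d'f)_{ij}=(-1)^{r'_j}d(f_{ij})$. For a closed morphism $f:A\to B$ of degree $0$ in $\mathcal T$, $\mathrm{cone}(f)=(A[1]\oplus B,q)$, where $q_{12}=f$ and the other entries of $q$ are $0$. Two objects of a dg category are homotopic if they are isomorphic in its homotopy category, whose morphisms are the $H^0$ of the Hom complexes. An object of $\mathcal T$ is viewed as the object $A[0]$ (with $q=0$) of $\mathcal T^{\text{pre-tr}}$. Then the following two conditions on $\mathcal T$ are equivalent. (I) (a) There is an object $0$ of $\mathcal T$ such that $\mathcal T(-,0)$ is weakly equivalent to the constant module with value the complex $0$. (b) Whenever $M$ is a $\mathcal T$-module such that $\Sigma M$ is weakly equivalent to a representable module $\mathcal T(-,c)$, then $M$ is weakly equivalent to a representable module. (c) Whenever $M$ and $N$ are $\mathcal T$-modules that are weakly equivalent to representable modules, the homotopy cofiber of every map of modules $M\to N$ is weakly equivalent to a representable module. (II) (a) The object $0$ (the empty sum) of $\mathcal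 T^{\text{pre-tr}}$ is homotopic to an object of $\mathcal T$. (b) For every $A\in\mathcal T$ and every $n\in\mathbb Z$, the object $A[n]$ of $\mathcal T^{\text{pre-tr}}$ is homotopic to an object of $\mathcal T$. (c) For every closed morphism $f$ of degree $0$ in $\mathcal T$, the object $\mathrm{cone}(f)$ of $\mathcal T^{\text{pre-tr}}$ is homotopic to an object of $\mathcal T$. -/

import Mathlib

open CategoryTheory

universe u v w

/-- The differential of a cochain complex of `k`-modules, as a `k`-linear map. -/
def CochainComplex.dLin {k : Type w} [CommRing k] (K : CochainComplex (ModuleCat.{v} k) ℤ)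
    (p q : ℤ) : K.X p →ₗ[k] K.X q :=
  (K.d p q).hom

theorem CochainComplex.dLin_dLin {k : Type w} [CommRing k]
    (K : CochainComplex (ModuleCat.{v} k) ℤ) (p q r : ℤ) (x : K.X p) :
    K.dLin q r (K.dLin p q x) = 0 := by
  have h := K.d_comp_d p q r
  exact congrArg (fun f => f.hom x) h

theorem CochainComplex.dLin_shape {k : Type w} [CommRing k]
    (K : CochainComplex (ModuleCat.{v} k) ℤ) (p q : ℤ) (h : p + 1 ≠ q) :
    K.dLin p q = 0 := by
  have h := K.shape p q h
  exact congrArg (fun f => f.hom) h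

/-! The structure maps of the mapping cone of a map of complexes of `k`-modules, whose term of degree
`n` is the direct sum of `F.X (n + 1)` and `G.X n`. -/

section

open CochainComplex HomComplex

variable {k : Type w} [CommRing k] {F G : CochainComplex (ModuleCat.{v} k) ℤ} (φ : F ⟶ G)

noncomputable def CochainComplex.coneInl (n : ℤ) : F.X (n + 1) →ₗ[k] (mappingCone φ).X n :=
  ((mappingCone.inl φ).v (n + 1) n (by lia)).hom

noncomputable def CochainComplex.coneInr (n : ℤ) : G.X n →ₗ[k] (mappingCone φ).X n :=
  ((mappingCone.inr φ).f n).hom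

noncomputable def CochainComplex.coneFst (n : ℤ) : (mappingCone φ).X n →ₗ[k] F.X (n + 1) :=
  ((mappingCone.fst φ).1.v n (n + 1) rfl).hom

noncomputable def CochainComplex.coneSnd (n : ℤ) : (mappingCone φ).X n →ₗ[k] G.X n :=
  ((mappingCone.snd φ).v n n (add_zero n)).hom

theorem CochainComplex.coneFst_coneInl (n : ℤ) (a : F.X (n + 1)) :
    coneFst φ n (coneInl φ n a) = a :=
  congrArg (fun f => f.hom a) (mappingCone.inl_v_fst_v φ (n + 1) n rfl)

theorem CochainComplex.coneSnd_coneInl (n : ℤ) (a : F.X (n + 1)) :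
    coneSnd φ n (coneInl φ n a) = 0 :=
  congrArg (fun f => f.hom a) (mappingCone.inl_v_snd_v φ (n + 1) n (by lia))

theorem CochainComplex.coneFst_coneInr (n : ℤ) (b : G.X n) :
    coneFst φ n (coneInr φ n b) = 0 :=
  congrArg (fun f => f.hom b) (mappingCone.inr_f_fst_v φ n (n + 1) rfl)

theorem CochainComplex.coneSnd_coneInr (n : ℤ) (b : G.X n) :
    coneSnd φ n (coneInr φ n b) = b :=
  congrArg (fun f => f.hom b) (mappingCone.inr_f_snd_v φ n)

theorem CochainComplex.cone_decomp (n : ℤ) (c : (mappingCone φ).X n) :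
    coneInl φ n (coneFst φ n c) + coneInr φ n (coneSnd φ n c) = c :=
  congrArg (fun f => f.hom c) (mappingCone.id_X φ n (n + 1) rfl)

theorem CochainComplex.coneFst_d (n m : ℤ) (h : n + 1 = m) (c : (mappingCone φ).X n) :
    coneFst φ m ((mappingCone φ).dLin n m c) = -F.dLin (n + 1) (m + 1) (coneFst φ n c) := by
  subst h
  exact congrArg (fun f => f.hom c) (mappingCone.d_fst_v φ n (n + 1) (n + 1 + 1) rfl rfl)

theorem CochainComplex.coneSnd_d (n m : ℤ) (h : n + 1 = m) (c : (mappingCone φ).X n) :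
    coneSnd φ m ((mappingCone φ).dLin n m c) =
      (φ.f m).hom ((F.XIsoOfEq h).hom.hom (coneFst φ n c)) + G.dLin n m (coneSnd φ n c) := by
  subst h
  exact congrArg (fun f => f.hom c) (mappingCone.d_snd_v φ n (n + 1) rfl)

theorem CochainComplex.cone_ext (n : ℤ) {c c' : (mappingCone φ).X n}
    (h₁ : coneFst φ n c = coneFst φ n c') (h₂ : coneSnd φ n c = coneSnd φ n c') : c = c' := by
  rw [← cone_decomp φ n c, ← cone_decomp φ n c', h₁, h₂]

end

/-- A differential graded category over `k`, with cohomological grading: Hom complexes, units and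
compositions `hom y z ⊗ hom x y ⟶ hom x z` which are maps of complexes (i.e. `d_one` and the
graded Leibniz rule `d_comp`), subject to associativity and the unit laws. The degrees of a
composition are kept flexible (`h : p + q = n`) to avoid transports. -/
structure DGCategory (k : Type w) [CommRing k] where
  Obj : Type u
  hom : Obj → Obj → CochainComplex (ModuleCat.{v} k) ℤ
  one (x : Obj) : (hom x x).X 0
  comp {x y z : Obj} {p q n : ℤ} (h : p + q = n) :
    (hom y z).X p →ₗ[k] (hom x y).X q →ₗ[k] (hom x z).X n
  d_one (x : Obj) : (hom x x).dLin 0 1 (one x) = 0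
  d_comp {x y z : Obj} {p q n p' q' n' : ℤ} (h : p + q = n) (hp : p + 1 = p') (hq : q + 1 = q')
    (hn : n + 1 = n') (g : (hom y z).X p) (f : (hom x y).X q) :
    (hom x z).dLin n n' (comp h g f) =
      comp (by lia : p' + q = n') ((hom y z).dLin p p' g) f +
        p.negOnePow • comp (by lia : p + q' = n') g ((hom x y).dLin q q' f)
  one_comp {x y : Obj} {p : ℤ} (f : (hom x y).X p) : comp (zero_add p) (one y) f = f
  comp_one {x y : Obj} {p : ℤ} (f : (hom x y).X p) : comp (add_zero p) f (one x) = f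
  assoc {x y z t : Obj} {p q r pq qr n : ℤ} (hpq : p + q = pq) (hqr : q + r = qr)
    (h : pq + r = n) (f₃ : (hom z t).X p) (f₂ : (hom y z).X q) (f₁ : (hom x y).X r) :
    comp h (comp hpq f₃ f₂) f₁ = comp (by lia : p + qr = n) f₃ (comp hqr f₂ f₁)

namespace DGCategory

variable {k : Type w} [CommRing k]

/-- Two objects of a dg category are homotopic if they are isomorphic in the homotopy category,
whose morphisms are the `H⁰` of the Hom complexes: there are closed morphisms of degree `0` in both
directions which are inverse to each other up to boundaries. -/
def Homotopic (T : DGCategory.{u, v, w} k) (x y : T.Obj) : Prop :=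
  ∃ (f : (T.hom x y).X 0) (g : (T.hom y x).X 0),
    (T.hom x y).dLin 0 1 f = 0 ∧ (T.hom y x).dLin 0 1 g = 0 ∧
    (∃ s : (T.hom x x).X (-1),
      T.comp (add_zero 0) g f - T.one x = (T.hom x x).dLin (-1) 0 s) ∧
    (∃ t : (T.hom y y).X (-1),
      T.comp (add_zero 0) f g - T.one y = (T.hom y y).dLin (-1) 0 t)

/-! ### Modules over a dg category -/

/-- A right module over a dg category `T`, i.e. a dg functor `Tᵒᵖ ⥤ Ch(k)`, written out in terms of
its (unsigned) action: the functor sends `f ∈ T(x, y)` of degree `q` to the map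
`m ↦ (-1)^(p * q) m · f` for `m` of degree `p`. -/
structure Mod (T : DGCategory.{u, v, w} k) where
  obj : T.Obj → CochainComplex (ModuleCat.{v} k) ℤ
  act {x y : T.Obj} {p q n : ℤ} (h : p + q = n) :
    (obj y).X p →ₗ[k] (T.hom x y).X q →ₗ[k] (obj x).X n
  d_act {x y : T.Obj} {p q n p' q' n' : ℤ} (h : p + q = n) (hp : p + 1 = p') (hq : q + 1 = q')
    (hn : n + 1 = n') (m : (obj y).X p) (f : (T.hom x y).X q) :
    (obj x).dLin n n' (act h m f) =
      act (by lia : p' + q = n') ((obj y).dLin p p' m) f +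
        p.negOnePow • act (by lia : p + q' = n') m ((T.hom x y).dLin q q' f)
  act_one {x : T.Obj} {p : ℤ} (m : (obj x).X p) : act (add_zero p) m (T.one x) = m
  act_act {x y z : T.Obj} {p q r pq qr n : ℤ} (hpq : p + q = pq) (hqr : q + r = qr)
    (h : pq + r = n) (m : (obj z).X p) (g : (T.hom y z).X q) (f : (T.hom x y).X r) :
    act h (act hpq m g) f = act (by lia : p + qr = n) m (T.comp hqr g f)

namespace Mod

variable {T : DGCategory.{u, v, w} k}

/-- A map of right modules: maps of complexes commuting with the action. -/
structure Hom (M N : T.Mod) where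
  app (x : T.Obj) : M.obj x ⟶ N.obj x
  app_act {x y : T.Obj} {p q n : ℤ} (h : p + q = n) (m : (M.obj y).X p) (f : (T.hom x y).X q) :
    ((app x).f n).hom (M.act h m f) = N.act h (((app y).f p).hom m) f

/-- A weak equivalence of modules is a pointwise quasi-isomorphism. -/
def Hom.IsWeakEquivalence {M N : T.Mod} (φ : Hom M N) : Prop :=
  ∀ x : T.Obj, QuasiIso (φ.app x)

/-- Two modules are weakly equivalent if they are connected by a zigzag of weak equivalences. -/
def WeaklyEquivalent (M N : T.Mod) : Prop :=
  Relation.EqvGen (fun M N : T.Mod => ∃ φ : Hom M N, φ.IsWeakEquivalence) M N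

/-- The constant module with value the complex `0`. -/
def zero (T : DGCategory.{u, v, w} k) : T.Mod where
  obj _ := { X := fun _ => ModuleCat.of k PUnit.{v + 1}, d := fun _ _ => 0 }
  act _ := 0
  d_act _ _ _ _ _ _ := rfl
  act_one _ := rfl
  act_act _ _ _ _ _ _ := rfl

/-- The representable module `T(-, c)`. -/
def representable (T : DGCategory.{u, v, w} k) (c : T.Obj) : T.Mod where
  obj x := T.hom x c
  act h := T.comp h
  d_act := T.d_comp
  act_one := T.comp_one
  act_act := T.assoc

/-- A module is weakly representable if it is weakly equivalent to a representable module. -/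
def WeaklyRepresentable (M : T.Mod) : Prop :=
  ∃ c : T.Obj, WeaklyEquivalent M (representable T c)

/-- The suspension of a module: the pointwise shift `(ΣM)(x) = M(x)[1]`. -/
def suspension (M : T.Mod) : T.Mod where
  obj x := (CochainComplex.shiftFunctor (ModuleCat.{v} k) 1).obj (M.obj x)
  act {_ _ p q n} h := M.act (by lia : (p + 1) + q = n + 1)
  d_act {x y p q n p' q' n'} h hp hq hn m f := by
    have key := M.d_act (by lia : (p + 1) + q = n + 1) (by lia : (p + 1) + 1 = p' + 1) hq
      (by lia : (n + 1) + 1 = n' + 1) m f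
    have e : ∀ (K : CochainComplex (ModuleCat.{v} k) ℤ) (i j : ℤ) (a : K.X (i + 1)),
        ((CochainComplex.shiftFunctor (ModuleCat.{v} k) 1).obj K).dLin i j a =
          (-K.dLin (i + 1) (j + 1) a : K.X (j + 1)) := by
      intro K i j a
      simp [CochainComplex.dLin, CochainComplex.shiftFunctor]
      rfl
    refine (e _ _ _ _).trans (((congrArg Neg.neg key).trans ?_).trans
      (congrArg (fun z : (M.obj y).X (p' + 1) =>
        M.act (by lia : (p' + 1) + q = n' + 1) z f +
          p.negOnePow • M.act (by lia : (p + 1) + q' = n' + 1) m ((T.hom x y).dLin q q' f))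
        (e _ _ _ _).symm))
    rw [Int.negOnePow_succ, map_neg, LinearMap.neg_apply, neg_add, Units.neg_smul, neg_neg]
  act_one {x p} m := M.act_one m
  act_act hpq hqr h m g f := M.act_act _ hqr _ m g f

/-- The action on the pointwise mapping cone of a map of modules, induced by those on `M`
(suspended) and on `N`. -/
noncomputable def coneAct {M N : T.Mod} (φ : Hom M N) {x y : T.Obj} {p q n : ℤ} (h : p + q = n) :
    (CochainComplex.mappingCone (φ.app y)).X p →ₗ[k] (T.hom x y).X q →ₗ[k]
      (CochainComplex.mappingCone (φ.app x)).X n :=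
  LinearMap.mk₂ k
    (fun c f =>
      CochainComplex.coneInl (φ.app x) n
        (M.act (by lia : (p + 1) + q = n + 1) (CochainComplex.coneFst (φ.app y) p c) f) +
      CochainComplex.coneInr (φ.app x) n (N.act h (CochainComplex.coneSnd (φ.app y) p c) f))
    (fun _ _ _ => by simp only [map_add, LinearMap.add_apply]; abel)
    (fun _ _ _ => by simp only [map_smul, LinearMap.smul_apply, smul_add])
    (fun _ _ _ => by simp only [map_add]; abel)
    (fun _ _ _ => by simp only [map_smul, smul_add])

theorem coneFst_coneAct {M N : T.Mod} (φ : Hom M N) {x y : T.Obj} {p q n : ℤ} (h : p + q = n)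
    (c : (CochainComplex.mappingCone (φ.app y)).X p) (f : (T.hom x y).X q) :
    CochainComplex.coneFst (φ.app x) n (coneAct φ h c f) =
      M.act (by lia : (p + 1) + q = n + 1) (CochainComplex.coneFst (φ.app y) p c) f := by
  rw [coneAct, LinearMap.mk₂_apply, map_add, CochainComplex.coneFst_coneInl,
    CochainComplex.coneFst_coneInr, add_zero]

theorem coneSnd_coneAct {M N : T.Mod} (φ : Hom M N) {x y : T.Obj} {p q n : ℤ} (h : p + q = n)
    (c : (CochainComplex.mappingCone (φ.app y)).X p) (f : (T.hom x y).X q) :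
    CochainComplex.coneSnd (φ.app x) n (coneAct φ h c f) =
      N.act h (CochainComplex.coneSnd (φ.app y) p c) f := by
  rw [coneAct, LinearMap.mk₂_apply, map_add, CochainComplex.coneSnd_coneInl,
    CochainComplex.coneSnd_coneInr, zero_add]

theorem act_XIsoOfEq (M : T.Mod) {x y : T.Obj} {p p' q n n' : ℤ} (h : p + q = n) (hp : p = p')
    (hn : n = n') (m : (M.obj y).X p) (f : (T.hom x y).X q) :
    (((M.obj x).XIsoOfEq hn).hom).hom (M.act h m f) =
      M.act (by lia : p' + q = n') ((((M.obj y).XIsoOfEq hp).hom).hom m) f := by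
  subst hp hn
  rfl

/-- The homotopy cofiber of a map of modules: the pointwise mapping cone. -/
noncomputable def homotopyCofiber {M N : T.Mod} (φ : Hom M N) : T.Mod where
  obj x := CochainComplex.mappingCone (φ.app x)
  act h := coneAct φ h
  d_act {x y p q n p' q' n'} h hp hq hn c f := by
    apply CochainComplex.cone_ext
    · rw [CochainComplex.coneFst_d _ _ _ hn, coneFst_coneAct,
        M.d_act _ (by lia : (p + 1) + 1 = p' + 1) hq (by lia : (n + 1) + 1 = n' + 1), map_add,
        coneFst_coneAct, CochainComplex.coneFst_d _ _ _ hp, Units.smul_def, Units.smul_def,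
        map_zsmul, coneFst_coneAct, Int.negOnePow_succ, map_neg, LinearMap.neg_apply, neg_add,
        Units.val_neg, neg_smul, neg_neg]
    · rw [CochainComplex.coneSnd_d _ _ _ hn, coneFst_coneAct, coneSnd_coneAct,
        N.d_act _ hp hq hn, map_add,
        coneSnd_coneAct, CochainComplex.coneSnd_d _ _ _ hp, Units.smul_def, Units.smul_def,
        map_zsmul, coneSnd_coneAct, map_add, LinearMap.add_apply,
        act_XIsoOfEq M _ hp hn, φ.app_act, add_assoc]
  act_one c := by
    apply CochainComplex.cone_ext
    · rw [coneFst_coneAct, M.act_one]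
    · rw [coneSnd_coneAct, N.act_one]
  act_act hpq hqr h c g f := by
    apply CochainComplex.cone_ext
    · rw [coneFst_coneAct, coneFst_coneAct, coneFst_coneAct, M.act_act _ hqr]
    · rw [coneSnd_coneAct, coneSnd_coneAct, coneSnd_coneAct, N.act_act _ hqr]

end Mod

/-- The module-theoretic definition of a pretriangulated dg category. -/
structure IsPretriangulated (T : DGCategory.{u, v, w} k) : Prop where
  exists_zero : ∃ z : T.Obj, Mod.WeaklyEquivalent (Mod.representable T z) (Mod.zero T)
  desuspension (M : T.Mod) : M.suspension.WeaklyRepresentable → M.WeaklyRepresentable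
  cofiber (M N : T.Mod) : M.WeaklyRepresentable → N.WeaklyRepresentable →
    ∀ φ : Mod.Hom M N, (Mod.homotopyCofiber φ).WeaklyRepresentable

/-! ### The dg category of twisted complexes -/

/-- A formal finite direct sum `C₁[r₁] ⊕ ⋯ ⊕ Cₙ[rₙ]` of shifts of objects of `T`. -/
structure FormalSum (T : DGCategory.{u, v, w} k) where
  n : ℕ
  obj : Fin n → T.Obj
  deg : Fin n → ℤ

namespace FormalSum

variable {T : DGCategory.{u, v, w} k}

/-- Matrices of morphisms between formal sums of shifts, of degree `l`: the entry `f i j` has degree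
`l` in `Hom(C i, C' j)[r' j - r i]`. -/
abbrev Matrices (K L : FormalSum T) (l : ℤ) : Type v :=
  ∀ (i : Fin K.n) (j : Fin L.n), (T.hom (K.obj i) (L.obj j)).X (l + L.deg j - K.deg i)

/-- The entrywise differential `d'`. The sign `(-1) ^ (r' j)` is the one for which `d'` satisfies the
graded Leibniz rule with respect to the product of matrices. -/
def matrixD (K L : FormalSum T) (l m : ℤ) : Matrices K L l →ₗ[k] Matrices K L m :=
  LinearMap.pi fun i => LinearMap.pi fun j =>
    (L.deg j).negOnePow • ((T.hom (K.obj i) (L.obj j)).dLin _ _ ∘ₗ LinearMap.proj j ∘ₗ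
      LinearMap.proj i)

theorem matrixD_apply (K L : FormalSum T) (l m : ℤ) (f : Matrices K L l) (i : Fin K.n)
    (j : Fin L.n) : matrixD K L l m f i j =
      (L.deg j).negOnePow • (T.hom (K.obj i) (L.obj j)).dLin _ _ (f i j) := rfl

/-- The complex of maps between two formal sums of shifts. -/
def homComplex (K L : FormalSum T) : CochainComplex (ModuleCat.{v} k) ℤ where
  X l := ModuleCat.of k (Matrices K L l)
  d l m := ModuleCat.ofHom (matrixD K L l m)
  shape l m h := ModuleCat.hom_ext <| LinearMap.ext fun f => funext fun i => funext fun j => by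
    change matrixD K L l m f i j = 0
    have h' : l + 1 ≠ m := h
    rw [matrixD_apply, CochainComplex.dLin_shape _ _ _ (by lia), LinearMap.zero_apply, smul_zero]
  d_comp_d' l m n _ _ := ModuleCat.hom_ext <| LinearMap.ext fun f => funext fun i =>
    funext fun j => by
    change matrixD K L m n (matrixD K L l m f) i j = 0
    rw [matrixD_apply, matrixD_apply, Units.smul_def, Units.smul_def, map_zsmul,
      CochainComplex.dLin_dLin, smul_zero, smul_zero]

/-- The product of matrices of morphisms. -/
def matrixComp (K L M : FormalSum T) {p q n : ℤ} (h : p + q = n) :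
    Matrices L M p →ₗ[k] Matrices K L q →ₗ[k] Matrices K M n :=
  LinearMap.mk₂ k
    (fun g f i l => ∑ j, T.comp (by lia : (p + M.deg l - L.deg j) + (q + L.deg j - K.deg i) =
      n + M.deg l - K.deg i) (g j l) (f i j))
    (fun _ _ _ => by
      funext i l
      simp only [Pi.add_apply, map_add, LinearMap.add_apply, Finset.sum_add_distrib])
    (fun _ _ _ => by
      funext i l
      simp only [Pi.smul_apply, map_smul, LinearMap.smul_apply, Finset.smul_sum])
    (fun _ _ _ => by
      funext i l
      simp only [Pi.add_apply, map_add, Finset.sum_add_distrib])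
    (fun _ _ _ => by
      funext i l
      simp only [Pi.smul_apply, map_smul, Finset.smul_sum])

theorem matrixComp_apply (K L M : FormalSum T) {p q n : ℤ} (h : p + q = n) (g : Matrices L M p)
    (f : Matrices K L q) (i : Fin K.n) (l : Fin M.n) : matrixComp K L M h g f i l =
      ∑ j, T.comp (by lia : (p + M.deg l - L.deg j) + (q + L.deg j - K.deg i) =
        n + M.deg l - K.deg i) (g j l) (f i j) := rfl

/-- The identity matrix. -/
def matrixOne (K : FormalSum T) : Matrices K K 0 := fun i j =>
  if h : i = j then
    (((T.hom (K.obj i) (K.obj j)).XIsoOfEq (by subst h; lia :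
      0 = 0 + K.deg j - K.deg i)).hom).hom (h ▸ T.one (K.obj i))
  else 0

theorem comp_XIsoOfEq {x y z : T.Obj} {p p' q n : ℤ} (hp : p = p') (h : p + q = n)
    (h' : p' + q = n) (g : (T.hom y z).X p) (f : (T.hom x y).X q) :
    T.comp h' ((((T.hom y z).XIsoOfEq hp).hom).hom g) f = T.comp h g f := by
  subst hp
  rfl

theorem comp_XIsoOfEq' {x y z : T.Obj} {p q q' n : ℤ} (hq : q = q') (h : p + q = n)
    (h' : p + q' = n) (g : (T.hom y z).X p) (f : (T.hom x y).X q) :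
    T.comp h' g ((((T.hom x y).XIsoOfEq hq).hom).hom f) = T.comp h g f := by
  subst hq
  rfl

theorem dLin_XIsoOfEq {x y : T.Obj} {p p' q : ℤ} (hp : p = p') (f : (T.hom x y).X p) :
    (T.hom x y).dLin p' q ((((T.hom x y).XIsoOfEq hp).hom).hom f) = (T.hom x y).dLin p q f := by
  subst hp
  rfl

theorem matrixOne_self (K : FormalSum T) (i : Fin K.n) : matrixOne K i i =
    (((T.hom (K.obj i) (K.obj i)).XIsoOfEq (by lia :
      0 = 0 + K.deg i - K.deg i)).hom).hom (T.one (K.obj i)) := by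
  simp [matrixOne]

theorem matrixOne_ne (K : FormalSum T) {i j : Fin K.n} (h : i ≠ j) : matrixOne K i j = 0 :=
  dif_neg h

theorem dLin_one (x : T.Obj) {n : ℤ} (h : n = 1) : (T.hom x x).dLin 0 n (T.one x) = 0 := by
  subst h
  exact T.d_one x

theorem matrixD_one (K : FormalSum T) : matrixD K K 0 1 (matrixOne K) = 0 := by
  funext i j
  rw [matrixD_apply]
  by_cases h : i = j
  · subst h
    rw [matrixOne_self, dLin_XIsoOfEq, dLin_one _ (by lia), smul_zero, Pi.zero_apply,
      Pi.zero_apply]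
  · rw [matrixOne_ne K h, map_zero, smul_zero, Pi.zero_apply, Pi.zero_apply]

theorem matrixD_comp {K L M : FormalSum T} {p q n p' q' n' : ℤ} (h : p + q = n) (hp : p + 1 = p')
    (hq : q + 1 = q') (hn : n + 1 = n') (g : Matrices L M p) (f : Matrices K L q) :
    matrixD K M n n' (matrixComp K L M h g f) =
      matrixComp K L M (by lia : p' + q = n') (matrixD L M p p' g) f +
        p.negOnePow • matrixComp K L M (by lia : p + q' = n') g (matrixD K L q q' f) := by
  funext i l
  rw [Pi.add_apply, Pi.add_apply, Pi.smul_apply, Pi.smul_apply, matrixD_apply, matrixComp_apply,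
    matrixComp_apply, matrixComp_apply, map_sum, Finset.smul_sum, Finset.smul_sum,
    ← Finset.sum_add_distrib]
  refine Finset.sum_congr rfl fun j _ => ?_
  rw [T.d_comp _ (by lia : _ = p' + M.deg l - L.deg j) (by lia : _ = q' + L.deg j - K.deg i)
    (by lia), matrixD_apply, matrixD_apply, smul_add, smul_smul]
  simp only [Units.smul_def, map_zsmul, LinearMap.smul_apply, smul_smul, ← Units.val_mul]
  congr 3
  rw [← Int.negOnePow_add, ← Int.negOnePow_add, Int.negOnePow_eq_iff]
  exact ⟨M.deg l - L.deg j, by ring⟩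

theorem matrixOne_comp {K L : FormalSum T} {p : ℤ} (f : Matrices K L p) :
    matrixComp K L L (zero_add p) (matrixOne L) f = f := by
  funext i l
  rw [matrixComp_apply, Finset.sum_eq_single l, matrixOne_self, comp_XIsoOfEq _ (by lia),
    T.one_comp]
  · intro j _ hj
    rw [matrixOne_ne L hj, map_zero, LinearMap.zero_apply]
  · simp

theorem matrixComp_one {K L : FormalSum T} {p : ℤ} (f : Matrices K L p) :
    matrixComp K K L (add_zero p) f (matrixOne K) = f := by
  funext i l
  rw [matrixComp_apply, Finset.sum_eq_single i, matrixOne_self, comp_XIsoOfEq' _ (by lia),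
    T.comp_one]
  · intro j _ hj
    rw [matrixOne_ne K hj.symm, map_zero]
  · simp

theorem matrixComp_assoc {K L M N : FormalSum T} {p q r pq qr n : ℤ} (hpq : p + q = pq)
    (hqr : q + r = qr) (h : pq + r = n) (f₃ : Matrices M N p) (f₂ : Matrices L M q)
    (f₁ : Matrices K L r) :
    matrixComp K L N h (matrixComp L M N hpq f₃ f₂) f₁ =
      matrixComp K M N (by lia : p + qr = n) f₃ (matrixComp K L M hqr f₂ f₁) := by
  funext i l
  simp only [matrixComp_apply, map_sum, LinearMap.sum_apply]
  rw [Finset.sum_comm]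
  refine Finset.sum_congr rfl fun j _ => Finset.sum_congr rfl fun j' _ => ?_
  exact T.assoc _ _ _ _ _ _

end FormalSum

open FormalSum in
/-- The dg category of formal finite direct sums of shifts of objects of `T`. -/
def formalSums (T : DGCategory.{u, v, w} k) : DGCategory.{u, v, w} k where
  Obj := FormalSum T
  hom := homComplex
  one := matrixOne
  comp {K L M _ _ _} h := matrixComp K L M h
  d_one := matrixD_one
  d_comp h hp hq hn g f := matrixD_comp h hp hq hn g f
  one_comp f := matrixOne_comp f
  comp_one f := matrixComp_one f
  assoc hpq hqr h f₃ f₂ f₁ := matrixComp_assoc hpq hqr h f₃ f₂ f₁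

/-- A Maurer-Cartan object of a dg category: an object with a degree `1` endomorphism `q` such that
`dq + q² = 0`. -/
structure MaurerCartan (S : DGCategory.{u, v, w} k) where
  obj : S.Obj
  q : (S.hom obj obj).X 1
  eq_zero : (S.hom obj obj).dLin 1 2 q + S.comp (by lia : (1 : ℤ) + 1 = 2) q q = 0

namespace MaurerCartan

variable {S : DGCategory.{u, v, w} k}

/-- The twisted differential `f ↦ df + q' f - (-1) ^ l f q` on maps of degree `l`. -/
def twistedD (K L : MaurerCartan S) (l m : ℤ) (h : l + 1 = m) :
    (S.hom K.obj L.obj).X l →ₗ[k] (S.hom K.obj L.obj).X m :=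
  (S.hom K.obj L.obj).dLin l m + S.comp (by lia : 1 + l = m) L.q -
    l.negOnePow • (S.comp h).flip K.q

theorem twistedD_apply (K L : MaurerCartan S) (l m : ℤ) (h : l + 1 = m)
    (f : (S.hom K.obj L.obj).X l) : twistedD K L l m h f =
      (S.hom K.obj L.obj).dLin l m f + S.comp (by lia : 1 + l = m) L.q f -
        l.negOnePow • S.comp h f K.q := rfl

theorem twistedD_twistedD (K L : MaurerCartan S) (l m n : ℤ) (h : l + 1 = m) (h' : m + 1 = n)
    (f : (S.hom K.obj L.obj).X l) : twistedD K L m n h' (twistedD K L l m h f) = 0 := by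
  have e₁ := congrArg (fun a => S.comp (by lia : 2 + l = n) a f) L.eq_zero
  have e₂ := congrArg (fun a => S.comp (by lia : l + 2 = n) f a) K.eq_zero
  simp only [map_add, LinearMap.add_apply, map_zero, LinearMap.zero_apply] at e₁ e₂
  have a₁ := S.assoc (by lia : (1 : ℤ) + 1 = 2) (by lia : 1 + l = m) (by lia : 2 + l = n)
    L.q L.q f
  have a₂ := S.assoc h (by lia : (1 : ℤ) + 1 = 2) h' f K.q K.q
  have a₃ := S.assoc (by lia : 1 + l = m) h h' L.q f K.q
  have b₁ := S.d_comp (by lia : 1 + l = m) (by lia : (1 : ℤ) + 1 = 2) h h' L.q f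
  have b₂ := S.d_comp h h (by lia : (1 : ℤ) + 1 = 2) h' f K.q
  subst h'
  rw [twistedD_apply, twistedD_apply]
  simp only [map_add, map_sub, LinearMap.add_apply, LinearMap.sub_apply, Units.smul_def,
    map_zsmul, LinearMap.smul_apply, CochainComplex.dLin_dLin, b₁, b₂, a₂, ← a₁, a₃, ← h,
    Int.negOnePow_succ, Int.negOnePow_one]
  rcases Int.units_eq_one_or l.negOnePow with e | e <;>
    simp only [e, Units.val_neg, Units.val_one, neg_smul, one_smul, neg_neg] <;>
    refine Eq.trans ?_ ((congrArg₂ (fun a b => a - b) e₁ e₂).trans (sub_zero 0)) <;>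
    abel

theorem twistedD_comp {K L M : MaurerCartan S} {p q n p' q' n' : ℤ} (h : p + q = n)
    (hp : p + 1 = p') (hq : q + 1 = q') (hn : n + 1 = n') (g : (S.hom L.obj M.obj).X p)
    (f : (S.hom K.obj L.obj).X q) :
    twistedD K M n n' hn (S.comp h g f) =
      S.comp (by lia : p' + q = n') (twistedD L M p p' hp g) f +
        p.negOnePow • S.comp (by lia : p + q' = n') g (twistedD K L q q' hq f) := by
  have a₁ := S.assoc (by lia : 1 + p = p') h (by lia : p' + q = n') M.q g f
  have a₂ := S.assoc h hq hn g f K.q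
  have a₃ := S.assoc hp (by lia : 1 + q = q') (by lia : p' + q = n') g L.q f
  rw [twistedD_apply, twistedD_apply, twistedD_apply, S.d_comp h hp hq hn, a₂, ← a₁]
  simp only [map_add, map_sub, LinearMap.add_apply, LinearMap.sub_apply, Units.smul_def,
    map_zsmul, LinearMap.smul_apply, a₃, ← h, Int.negOnePow_add, Units.val_mul]
  rcases Int.units_eq_one_or p.negOnePow with e | e <;>
    simp only [e, Units.val_neg, Units.val_one, neg_smul, one_smul, neg_mul, one_mul] <;>
    abel

theorem twistedD_one (K : MaurerCartan S) : twistedD K K 0 1 (by lia) (S.one K.obj) = 0 := by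
  rw [twistedD_apply, S.d_one, S.one_comp, S.comp_one, Int.negOnePow_zero, one_smul, zero_add,
    sub_self]

/-- The twisted Hom complex. -/
def homComplex (K L : MaurerCartan S) : CochainComplex (ModuleCat.{v} k) ℤ where
  X l := (S.hom K.obj L.obj).X l
  d l m := if h : l + 1 = m then ModuleCat.ofHom (twistedD K L l m h) else 0
  shape l m h := dif_neg h
  d_comp_d' l m n h h' := by
    have h₁ : l + 1 = m := h
    have h₂ : m + 1 = n := h'
    rw [dif_pos h₁, dif_pos h₂]
    exact ModuleCat.hom_ext <| LinearMap.ext fun f => twistedD_twistedD K L l m n h₁ h₂ f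

theorem homComplex_dLin (K L : MaurerCartan S) (l m : ℤ) (h : l + 1 = m) :
    (homComplex K L).dLin l m = twistedD K L l m h := by
  have e : (homComplex K L).d l m = ModuleCat.ofHom (twistedD K L l m h) := dif_pos h
  exact congrArg ModuleCat.Hom.hom e

end MaurerCartan

open MaurerCartan in
/-- The dg category of Maurer-Cartan objects of a dg category, with composition that of `S`. -/
def twist (S : DGCategory.{u, v, w} k) : DGCategory.{max u v, v, w} k where
  Obj := MaurerCartan S
  hom := homComplex
  one K := S.one K.obj
  comp h := S.comp h
  d_one K := by
    rw [homComplex_dLin K K 0 1 (by lia)]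
    exact twistedD_one K
  d_comp {K L M p q n p' q' n'} h hp hq hn g f := by
    rw [homComplex_dLin _ _ _ _ hp, homComplex_dLin _ _ _ _ hq, homComplex_dLin _ _ _ _ hn]
    exact twistedD_comp h hp hq hn g f
  one_comp f := S.one_comp f
  comp_one f := S.comp_one f
  assoc hpq hqr h f₃ f₂ f₁ := S.assoc hpq hqr h f₃ f₂ f₁

/-- The dg category `T^{pre-tr}`: its objects are the pairs of a formal sum `⊕ Cᵢ[rᵢ]` and a
matrix `q` of degree `1` with `dq + q² = 0`, its morphisms are matrices, and the differential of a
matrix `f` of degree `l` is `d'f + q'f - (-1) ^ l f q`. -/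
def preTr (T : DGCategory.{u, v, w} k) : DGCategory.{max u v, v, w} k :=
  T.formalSums.twist

/-- The object `0` of `T^{pre-tr}`, i.e. the empty sum. -/
def preTrZero (T : DGCategory.{u, v, w} k) : T.preTr.Obj where
  obj := { n := 0, obj := Fin.elim0, deg := Fin.elim0 }
  q := fun i => i.elim0
  eq_zero := funext fun i => i.elim0

/-- The object `A[r]` of `T^{pre-tr}`. -/
def preTrShift (T : DGCategory.{u, v, w} k) (A : T.Obj) (r : ℤ) : T.preTr.Obj where
  obj := { n := 1, obj := fun _ => A, deg := fun _ => r }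
  q := (0 : (T.formalSums.hom _ _).X 1)
  eq_zero := by rw [map_zero, map_zero, add_zero]

/-- The matrix `q` of the cone of `f : A ⟶ B`: the only nonzero entry is the one from `A[1]` to `B`,
which is `f`. -/
def coneMatrix (T : DGCategory.{u, v, w} k) {A B : T.Obj} (f : (T.hom A B).X 0) :
    FormalSum.Matrices (T := T) ⟨2, ![A, B], ![1, 0]⟩ ⟨2, ![A, B], ![1, 0]⟩ 1
  | 0, 1 => f
  | 0, 0 => 0
  | 1, 0 => 0
  | 1, 1 => 0

/-- The object `cone(f) = (A[1] ⊕ B, q)` of `T^{pre-tr}`, for a closed morphism `f : A ⟶ B` of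
degree `0`. -/
def preTrCone (T : DGCategory.{u, v, w} k) {A B : T.Obj} (f : (T.hom A B).X 0)
    (hf : (T.hom A B).dLin 0 1 f = 0) : T.preTr.Obj where
  obj := ⟨2, ![A, B], ![1, 0]⟩
  q := T.coneMatrix f
  eq_zero := by
    have h₁ : FormalSum.matrixD (T := T) ⟨2, ![A, B], ![1, 0]⟩ ⟨2, ![A, B], ![1, 0]⟩ 1 2
        (T.coneMatrix f) = 0 := by
      funext i j
      rw [FormalSum.matrixD_apply]
      match i, j with
      | 0, 1 =>
        exact (congrArg (fun a : (T.hom A B).X 1 => (0 : ℤ).negOnePow • a) hf).trans (smul_zero _)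
      | 0, 0 => exact (congrArg _ (map_zero _)).trans (smul_zero _)
      | 1, 0 => exact (congrArg _ (map_zero _)).trans (smul_zero _)
      | 1, 1 => exact (congrArg _ (map_zero _)).trans (smul_zero _)
    have h₂ : FormalSum.matrixComp (T := T) ⟨2, ![A, B], ![1, 0]⟩ ⟨2, ![A, B], ![1, 0]⟩
        ⟨2, ![A, B], ![1, 0]⟩ (by lia : (1 : ℤ) + 1 = 2) (T.coneMatrix f) (T.coneMatrix f) = 0 := by
      funext i j
      rw [FormalSum.matrixComp_apply]
      refine Finset.sum_eq_zero fun l _ => ?_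
      match i, l, j with
      | 0, 0, _ => exact map_zero _
      | 1, 0, _ => exact map_zero _
      | 1, 1, _ => exact map_zero _
      | 0, 1, 0 => exact LinearMap.congr_fun (map_zero _) _
      | 0, 1, 1 => exact LinearMap.congr_fun (map_zero _) _
    exact (congrArg₂ (fun a b => a + b) h₁ h₂).trans (add_zero _)

/-- An object of `T^{pre-tr}` is homotopic to an object of `T` if it is homotopic to some `A`,
viewed as `A[0]`. -/
def IsHomotopicToObject (T : DGCategory.{u, v, w} k) (K : T.preTr.Obj) : Prop :=
  ∃ A : T.Obj, T.preTr.Homotopic K (T.preTrShift A 0)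

/-- The definition of a pretriangulated dg category of Bondal and Kapranov. -/
structure IsPretriangulatedBK (T : DGCategory.{u, v, w} k) : Prop where
  zero : T.IsHomotopicToObject T.preTrZero
  shift (A : T.Obj) (r : ℤ) : T.IsHomotopicToObject (T.preTrShift A r)
  cone {A B : T.Obj} (f : (T.hom A B).X 0) (hf : (T.hom A B).dLin 0 1 f = 0) :
    T.IsHomotopicToObject (T.preTrCone f hf)

end DGCategory

/-!
Both notions of pretriangulated dg category are translated into the same conditions on elements of
the Hom complexes of `T`, in which neither modules nor matrices appear.

On the side of `T^{pre-tr}`, a homotopy equivalence between `0`, `A[r]` or `cone(f)` and an object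
of `T` is a finite system of matrices of size at most `2`. Writing out their entries, the condition
on `0` becomes a contraction of the identity of an object, that on `A[r]` becomes `IsShift`, and
that on `cone(f)` becomes `IsCone`; see `isHomotopicToObject_zero_iff`, `homotopic_shift_iff`,
`homotopic_cone_iff` and their summary `isPretriangulatedBK_iff`.

On the side of modules, the Yoneda lemma attaches a map `T(-, c) ⟶ M` to each closed element of
degree `0` of `M(c)`. Closed elements lift along quasi-isomorphisms up to a boundary, so the
existence of such a map which is a weak equivalence is invariant under zigzags of weak equivalences
(`Mod.weaklyEquivalent_representable_iff`). Hence "weakly representable" means `Mod.Represents c`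
for some `c`, which is again a statement on elements.

From Bondal-Kapranov to modules:
* if `ΣM` is represented by `c`, and `c'` is a shift of `c` by `-1`, then `M` is represented by `c'`
  (`Mod.Represents.of_suspension`);
* if `M` and `N` are represented by `a` and `b`, a map `φ : M ⟶ N` lifts, up to homotopy, to a
  closed morphism `f : a ⟶ b`. The resulting square commutes up to a homotopy, which induces a weak
  equivalence from the homotopy cofiber of `T(-, a) ⟶ T(-, b)` to that of `φ`
  (`Mod.cofiberMap_isWeakEquivalence`), and the former is represented by any object which is a cone
  of `f` (`IsCone.represents`).

From modules to Bondal-Kapranov: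
* the homotopy cofiber of `T(-, A) ⟶ 0` is `ΣT(-, A)`, so an object representing it is a shift of
  `A` by `1`, while the suspension of `Σ⁻¹T(-, A)` is represented by `A`, so that an object
  representing `Σ⁻¹T(-, A)` is a shift of `A` by `-1`. All shifts are iterations of these two
  (`exists_isShift_of_one_of_neg_one`);
* an object representing the homotopy cofiber of `T(-, A) ⟶ T(-, B)` is a cone of `f : A ⟶ B`
  (`Mod.Represents.isCone`).
-/

/-! ### Quasi-isomorphisms in terms of elements -/

namespace CochainComplex

variable {k : Type w} [CommRing k]

theorem dLin_hom {K L : CochainComplex (ModuleCat.{v} k) ℤ} (φ : K ⟶ L) (p q : ℤ) (x : K.X p) :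
    L.dLin p q ((φ.f p).hom x) = (φ.f q).hom (K.dLin p q x) :=
  congrArg (fun f => f.hom x) (φ.comm p q)

/-- A map of complexes is a quasi-isomorphism if and only if it is injective and surjective on
cohomology, spelled out in terms of cycles and boundaries. -/
theorem quasiIso_iff_forall {K L : CochainComplex (ModuleCat.{v} k) ℤ} (φ : K ⟶ L) :
    QuasiIso φ ↔
      (∀ (i : ℤ) (x : K.X (i + 1)) (y : L.X i), K.dLin (i + 1) (i + 1 + 1) x = 0 →
        (φ.f (i + 1)).hom x = L.dLin i (i + 1) y → ∃ x' : K.X i, K.dLin i (i + 1) x' = x) ∧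
      (∀ (i : ℤ) (y : L.X (i + 1)), L.dLin (i + 1) (i + 1 + 1) y = 0 →
        ∃ (x : K.X (i + 1)) (z : L.X i), K.dLin (i + 1) (i + 1 + 1) x = 0 ∧
          y = (φ.f (i + 1)).hom x + L.dLin i (i + 1) z) := by
  have key : ∀ i : ℤ, QuasiIsoAt φ (i + 1) ↔
      (∀ (x : K.X (i + 1)) (y : L.X i), K.dLin (i + 1) (i + 1 + 1) x = 0 →
        (φ.f (i + 1)).hom x = L.dLin i (i + 1) y → ∃ x' : K.X i, K.dLin i (i + 1) x' = x) ∧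
      (∀ (y : L.X (i + 1)), L.dLin (i + 1) (i + 1 + 1) y = 0 →
        ∃ (x : K.X (i + 1)) (z : L.X i), K.dLin (i + 1) (i + 1 + 1) x = 0 ∧
          y = (φ.f (i + 1)).hom x + L.dLin i (i + 1) z) := by
    intro i
    rw [quasiIsoAt_iff' φ i (i + 1) (i + 1 + 1) (by simp) (by simp)]
    set S₁ := K.sc' i (i + 1) (i + 1 + 1)
    set S₂ := L.sc' i (i + 1) (i + 1 + 1)
    set ψ : S₁ ⟶ S₂ :=
      (HomologicalComplex.shortComplexFunctor' _ _ i (i + 1) (i + 1 + 1)).map φ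
    let γ : ShortComplex.LeftHomologyMapData ψ S₁.moduleCatLeftHomologyData
      S₂.moduleCatLeftHomologyData := default
    -- homology is the quotient of the kernel by the image, and `γ.φH` is the map of quotients
    rw [γ.quasiIso_iff, ConcreteCategory.isIso_iff_bijective]
    have hK : ∀ x, (γ.φK.hom x).1 = (φ.f (i + 1)).hom x.1 := fun x =>
      congrArg (fun f => f.hom x) γ.commi
    have hH : ∀ x, γ.φH.hom (Submodule.Quotient.mk x) = Submodule.Quotient.mk (γ.φK.hom x) :=
      fun x => congrArg (fun f => f.hom x) γ.commπ
    have hq₁ : ∀ x : LinearMap.ker S₁.g.hom,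
        (Submodule.Quotient.mk x : LinearMap.ker S₁.g.hom ⧸ LinearMap.range S₁.moduleCatToCycles)
          = 0 ↔ ∃ x', K.dLin i (i + 1) x' = x.1 := by
      intro x
      rw [Submodule.Quotient.mk_eq_zero, LinearMap.mem_range]
      exact exists_congr fun _ => Subtype.ext_iff
    have hq₂ : ∀ x : LinearMap.ker S₂.g.hom,
        (Submodule.Quotient.mk x : LinearMap.ker S₂.g.hom ⧸ LinearMap.range S₂.moduleCatToCycles)
          = 0 ↔ ∃ x', L.dLin i (i + 1) x' = x.1 := by
      intro x
      rw [Submodule.Quotient.mk_eq_zero, LinearMap.mem_range]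
      exact exists_congr fun _ => Subtype.ext_iff
    refine and_congr ?_ ?_
    · refine (injective_iff_map_eq_zero γ.φH.hom).trans ⟨fun h x y hx hy => ?_, fun h => ?_⟩
      · refine (hq₁ ⟨x, hx⟩).1 (h _ ((hH _).trans ((hq₂ _).2 ⟨y, ?_⟩)))
        exact hy.symm.trans (hK ⟨x, hx⟩).symm
      · rintro ⟨x⟩ hx
        obtain ⟨y, hy⟩ := (hq₂ _).1 ((hH x).symm.trans hx)
        exact (hq₁ x).2 (h x.1 y x.2 ((hK x).symm.trans hy.symm))
    · constructor
      · intro h y hy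
        obtain ⟨⟨x⟩, hx⟩ := h (Submodule.Quotient.mk ⟨y, hy⟩)
        have h' := (hH x).symm.trans hx
        obtain ⟨z, hz⟩ := (hq₂ _).1 (sub_eq_zero.2 h'.symm)
        refine ⟨x.1, z, x.2, ?_⟩
        refine (add_eq_of_eq_sub' ?_).symm
        exact hz.trans (congrArg (fun t => y - t) (hK x))
      · rintro h ⟨y⟩
        obtain ⟨x, z, hx, hz⟩ := h y.1 y.2
        refine ⟨Submodule.Quotient.mk ⟨x, hx⟩, ?_⟩
        refine (hH _).trans (Eq.symm (sub_eq_zero.1 ?_))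
        refine (hq₂ (y - _)).2 ⟨z, ?_⟩
        refine Eq.trans ?_ (congrArg (fun t => y.1 - t) (hK _).symm)
        exact eq_sub_of_add_eq' hz.symm
  refine ⟨fun h => ⟨fun i => ((key i).1 inferInstance).1, fun i => ((key i).1 inferInstance).2⟩,
    fun h => ⟨fun i => ?_⟩⟩
  obtain ⟨j, rfl⟩ : ∃ j, i = j + 1 := ⟨i - 1, by lia⟩
  exact (key j).2 ⟨h.1 j, h.2 j⟩

variable {k : Type w} [CommRing k] {K L : CochainComplex (ModuleCat.{v} k) ℤ} {φ : K ⟶ L}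

theorem exists_dLin_eq_of_quasiIso (hφ : QuasiIso φ) {i j l : ℤ} (hij : i + 1 = j)
    (hjl : j + 1 = l) {x : K.X j} (hx : K.dLin j l x = 0) {y : L.X i}
    (hy : (φ.f j).hom x = L.dLin i j y) : ∃ x' : K.X i, K.dLin i j x' = x := by
  subst hij hjl
  exact ((quasiIso_iff_forall φ).1 hφ).1 i x y hx hy

theorem exists_eq_add_dLin_of_quasiIso (hφ : QuasiIso φ) {i j l : ℤ} (hij : i + 1 = j)
    (hjl : j + 1 = l) {y : L.X j} (hy : L.dLin j l y = 0) :
    ∃ (x : K.X j) (z : L.X i), K.dLin j l x = 0 ∧ y = (φ.f j).hom x + L.dLin i j z := by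
  subst hij hjl
  exact ((quasiIso_iff_forall φ).1 hφ).2 i y hy

/-- Relative lifting along a quasi-isomorphism: a cycle `x` whose image is the boundary of `y` is
itself the boundary of an element whose image is `y` up to a boundary. -/
theorem exists_lift_of_quasiIso (hφ : QuasiIso φ) {h i j l : ℤ} (hhi : h + 1 = i)
    (hij : i + 1 = j) (hjl : j + 1 = l) {x : K.X j} (hx : K.dLin j l x = 0) {y : L.X i}
    (hy : (φ.f j).hom x = L.dLin i j y) :
    ∃ (x' : K.X i) (z : L.X h), K.dLin i j x' = x ∧ y = (φ.f i).hom x' + L.dLin h i z := by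
  obtain ⟨x', hx'⟩ := exists_dLin_eq_of_quasiIso hφ hij hjl hx hy
  obtain ⟨c, z, hc, hz⟩ := exists_eq_add_dLin_of_quasiIso hφ hhi hij
    (y := y - (φ.f i).hom x') (by rw [map_sub, dLin_hom, hx', hy, sub_self])
  refine ⟨x' + c, z, by rw [map_add, hx', hc, add_zero], ?_⟩
  rw [map_add, add_assoc, ← hz, add_sub_cancel]

/-- Relative lifting characterizes quasi-isomorphisms: injectivity on cohomology is immediate, and
surjectivity is the case `x = 0`. -/
theorem quasiIso_of_exists_lift
    (hφ : ∀ (h i j l : ℤ), h + 1 = i → i + 1 = j → j + 1 = l → ∀ (x : K.X j) (y : L.X i),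
      K.dLin j l x = 0 → (φ.f j).hom x = L.dLin i j y →
      ∃ (x' : K.X i) (z : L.X h), K.dLin i j x' = x ∧ y = (φ.f i).hom x' + L.dLin h i z) :
    QuasiIso φ := by
  refine (quasiIso_iff_forall φ).2 ⟨fun i x y hx hy => ?_, fun i y hy => ?_⟩
  · obtain ⟨x', _, hx', _⟩ := hφ (i - 1) i _ _ (by lia) rfl rfl x y hx hy
    exact ⟨x', hx'⟩
  · obtain ⟨x, z, hx, hz⟩ := hφ i _ _ _ rfl rfl rfl 0 y (map_zero _) (by rw [hy, map_zero])
    exact ⟨x, z, hx, hz⟩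

/-- A map which agrees on cycles with a quasi-isomorphism, up to boundaries, is a
quasi-isomorphism. The function `s` need not be linear. -/
theorem quasiIso_of_homotopic {φ ψ : K ⟶ L} (hφ : QuasiIso φ) (s : ∀ p q : ℤ, K.X p → L.X q)
    (hs : ∀ (i : ℤ) (x : K.X (i + 1)), K.dLin (i + 1) (i + 1 + 1) x = 0 →
      (ψ.f (i + 1)).hom x = (φ.f (i + 1)).hom x + L.dLin i (i + 1) (s (i + 1) i x)) :
    QuasiIso ψ := by
  refine (quasiIso_iff_forall ψ).2 ⟨fun i x y hx hy => ?_, fun i y hy => ?_⟩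
  · refine exists_dLin_eq_of_quasiIso hφ rfl rfl hx (y := y - s _ _ x) ?_
    rw [map_sub, ← hy, hs i x hx, add_sub_cancel_right]
  · obtain ⟨x, z, hx, rfl⟩ := exists_eq_add_dLin_of_quasiIso hφ rfl rfl hy
    refine ⟨x, z - s _ _ x, hx, ?_⟩
    rw [hs i x hx, map_sub]
    abel

end CochainComplex

namespace DGCategory

open CochainComplex

variable {k : Type w} [CommRing k] {T : DGCategory.{u, v, w} k}

namespace Mod

/-! ### The Yoneda lemma and weakly representable modules -/

theorem d_act_of_left (M : T.Mod) {x y : T.Obj} {p q n q' n' : ℤ} (h : p + q = n)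
    (hq : q + 1 = q') (hn : n + 1 = n') {m : (M.obj y).X p}
    (hm : (M.obj y).dLin p (p + 1) m = 0) (f : (T.hom x y).X q) :
    (M.obj x).dLin n n' (M.act h m f) =
      p.negOnePow • M.act (by lia : p + q' = n') m ((T.hom x y).dLin q q' f) := by
  rw [M.d_act h rfl hq hn, hm, map_zero, LinearMap.zero_apply, zero_add]

theorem d_act_of_right (M : T.Mod) {x y : T.Obj} {p q n p' n' : ℤ} (h : p + q = n)
    (hp : p + 1 = p') (hn : n + 1 = n') (m : (M.obj y).X p) {f : (T.hom x y).X q}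
    (hf : (T.hom x y).dLin q (q + 1) f = 0) :
    (M.obj x).dLin n n' (M.act h m f) =
      M.act (by lia : p' + q = n') ((M.obj y).dLin p p' m) f := by
  rw [M.d_act h hp rfl hn, hf, map_zero, smul_zero, add_zero]

/-- The map of modules `T(-, c) ⟶ M`, `f ↦ m · f`, given by a closed element `m` of degree `0` of
`M(c)`. -/
def yoneda (M : T.Mod) {c : T.Obj} (m : (M.obj c).X 0) (hm : (M.obj c).dLin 0 1 m = 0) :
    Hom (representable T c) M where
  app x :=
    { f := fun n => ModuleCat.ofHom (M.act (zero_add n) m : (T.hom x c).X n →ₗ[k] (M.obj x).X n)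
      comm' := fun i j hij => ModuleCat.hom_ext <| LinearMap.ext fun f => by
        have hij : i + 1 = j := hij
        refine (M.d_act_of_left (zero_add i) hij hij hm f).trans ?_
        rw [Int.negOnePow_zero, one_smul]
        rfl }
  app_act h g f := (M.act_act _ h _ m g f).symm

/-- `c` represents `M`: some closed element of degree `0` of `M(c)` induces a weak equivalence
`T(-, c) ⟶ M`. -/
def Represents (M : T.Mod) (c : T.Obj) : Prop :=
  ∃ (m : (M.obj c).X 0) (hm : (M.obj c).dLin 0 1 m = 0), (yoneda M m hm).IsWeakEquivalence

theorem represents_representable (c : T.Obj) : (representable T c).Represents c := by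
  refine ⟨T.one c, T.d_one c, fun x => ?_⟩
  have e : (yoneda (representable T c) (T.one c) (T.d_one c)).app x = 𝟙 _ := by
    ext n f
    exact T.one_comp f
  rw [e]
  infer_instance

theorem Represents.of_hom {M N : T.Mod} (φ : Hom M N) (hφ : φ.IsWeakEquivalence) {c : T.Obj}
    (hM : M.Represents c) : N.Represents c := by
  obtain ⟨m, hm, h⟩ := hM
  have hn : (N.obj c).dLin 0 1 (((φ.app c).f 0).hom m) = 0 := by rw [dLin_hom, hm, map_zero]
  refine ⟨_, hn, fun x => ?_⟩
  have e : (yoneda N _ hn).app x = (yoneda M m hm).app x ≫ φ.app x := by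
    ext n f
    exact (φ.app_act (zero_add n) m f).symm
  rw [e]
  have := h x
  have := hφ x
  infer_instance

/-- The element of `N(c)` lifts to a closed element of `M(c)` up to a boundary `dz`, and acting on
`z` gives a homotopy between the two resulting maps `T(-, c) ⟶ N`. -/
theorem Represents.of_hom' {M N : T.Mod} (φ : Hom M N) (hφ : φ.IsWeakEquivalence) {c : T.Obj}
    (hN : N.Represents c) : M.Represents c := by
  obtain ⟨n, hn, h⟩ := hN
  obtain ⟨m, z, hm, hz⟩ := exists_eq_add_dLin_of_quasiIso (hφ c) (by lia : (-1 : ℤ) + 1 = 0)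
    (by lia : (0 : ℤ) + 1 = 1) hn
  refine ⟨m, hm, fun x => ?_⟩
  have := hφ x
  rw [← quasiIso_iff_comp_right ((yoneda M m hm).app x) (φ.app x)]
  refine quasiIso_of_homotopic (h x)
    (fun p q f => if hpq : -1 + p = q then -N.act hpq z f else 0)
    fun i (f : (T.hom x c).X (i + 1)) (hf : (T.hom x c).dLin _ _ f = 0) => ?_
  have h₁ := N.d_act_of_right (by lia : -1 + (i + 1) = i) (by lia : (-1 : ℤ) + 1 = 0) rfl z hf
  have h₂ : ((φ.app x).f (i + 1)).hom (M.act (zero_add _) m f) =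
      N.act (zero_add _) n f + -N.act (zero_add _) ((N.obj c).dLin (-1) 0 z) f := by
    rw [φ.app_act, hz, map_add, LinearMap.add_apply, add_neg_cancel_right]
  rw [dif_pos (by lia), map_neg, h₁]
  exact h₂

/-- A zigzag of weak equivalences between `M` and `T(-, c)` can be replaced by a single weak
equivalence `T(-, c) ⟶ M`. -/
theorem weaklyEquivalent_representable_iff (M : T.Mod) (c : T.Obj) :
    WeaklyEquivalent M (representable T c) ↔ M.Represents c := by
  constructor
  · intro h
    have key : ∀ {N N' : T.Mod}, WeaklyEquivalent N N' → (N.Represents c ↔ N'.Represents c) := by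
      intro N N' h
      induction h with
      | rel _ _ h =>
        obtain ⟨φ, hφ⟩ := h
        exact ⟨.of_hom φ hφ, .of_hom' φ hφ⟩
      | refl => rfl
      | symm _ _ _ ih => exact ih.symm
      | trans _ _ _ _ _ ih₁ ih₂ => exact ih₁.trans ih₂
    exact (key h).2 (represents_representable c)
  · rintro ⟨m, hm, h⟩
    exact .symm _ _ (.rel _ _ ⟨_, h⟩)

theorem weaklyRepresentable_iff (M : T.Mod) :
    M.WeaklyRepresentable ↔ ∃ c, M.Represents c :=
  exists_congr (weaklyEquivalent_representable_iff M)

end Mod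

/-! ### Zero and shifts in `T^{pre-tr}` -/

theorem preTr_dLin_apply (K L : T.preTr.Obj) {l m : ℤ} (h : l + 1 = m)
    (f : FormalSum.Matrices K.obj L.obj l) (i : Fin K.obj.n) (j : Fin L.obj.n) :
    ((T.preTr.hom K L).dLin l m f : FormalSum.Matrices K.obj L.obj m) i j =
      (L.obj.deg j).negOnePow • (T.hom (K.obj.obj i) (L.obj.obj j)).dLin _ _ (f i j) +
        ∑ r, T.comp (by lia) ((L.q : FormalSum.Matrices L.obj L.obj 1) r j) (f i r) -
        l.negOnePow • ∑ r, T.comp (by lia) (f r j) ((K.q : FormalSum.Matrices K.obj K.obj 1) i r) :=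
  congrArg (fun φ => (φ f : FormalSum.Matrices K.obj L.obj m) i j)
    (MaurerCartan.homComplex_dLin K L l m h)

/-- A morphism of degree `l` from `A[r]` to `B[r']` is a matrix with one entry, of degree
`l + r' - r`. -/
def shiftHom (A B : T.Obj) (r r' l : ℤ) : (T.hom A B).X (l + r' - r) ≃ₗ[k]
    (T.preTr.hom (T.preTrShift A r) (T.preTrShift B r')).X l where
  toFun x := fun _ _ => x
  invFun f := (f : FormalSum.Matrices _ _ _) (0 : Fin 1) (0 : Fin 1)
  map_add' _ _ := rfl
  map_smul' _ _ := rfl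
  left_inv _ := rfl
  right_inv f := by
    funext i j
    match i, j with
    | ⟨0, _⟩, ⟨0, _⟩ => rfl

theorem dLin_shiftHom {A B : T.Obj} {r r' l m : ℤ} (h : l + 1 = m)
    (x : (T.hom A B).X (l + r' - r)) :
    (T.preTr.hom (T.preTrShift A r) (T.preTrShift B r')).dLin l m (shiftHom A B r r' l x) =
      shiftHom A B r r' m (r'.negOnePow • (T.hom A B).dLin _ _ x) := by
  funext i j
  refine (preTr_dLin_apply (T.preTrShift A r) (T.preTrShift B r') h _ i j).trans ?_
  rw [Finset.sum_eq_zero, Finset.sum_eq_zero, smul_zero, sub_zero, add_zero]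
  · rfl
  · exact fun _ _ => map_zero (T.comp _ _)
  · exact fun _ _ => LinearMap.congr_fun (map_zero (T.comp _)) _

theorem comp_shiftHom {A B C : T.Obj} {r r' r'' p q n : ℤ} (h : p + q = n)
    (g : (T.hom B C).X (p + r'' - r')) (f : (T.hom A B).X (q + r' - r)) :
    T.preTr.comp h (shiftHom B C r' r'' p g) (shiftHom A B r r' q f) =
      shiftHom A C r r'' n (T.comp (by lia) g f) := by
  funext i j
  refine (FormalSum.matrixComp_apply (T.preTrShift A r).obj (T.preTrShift B r').obj
    (T.preTrShift C r'').obj h _ _ i j).trans ?_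
  exact Fin.sum_univ_one _

theorem preTr_one_shift (A : T.Obj) (r : ℤ) :
    T.preTr.one (T.preTrShift A r) = shiftHom A A r r 0
      ((((T.hom A A).XIsoOfEq (by lia)).hom).hom (T.one A)) := by
  funext i j
  match i, j with
  | ⟨0, _⟩, ⟨0, _⟩ => exact FormalSum.matrixOne_self (T.preTrShift A r).obj (0 : Fin 1)

theorem isHomotopicToObject_zero_iff :
    T.IsHomotopicToObject T.preTrZero ↔
      ∃ (z : T.Obj) (s : (T.hom z z).X (-1)), (T.hom z z).dLin (-1) 0 s = T.one z := by
  refine exists_congr fun z => ?_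
  have h₀ (f : (T.preTr.hom T.preTrZero (T.preTrShift z 0)).X 0)
      (g : (T.preTr.hom (T.preTrShift z 0) T.preTrZero).X 0) : T.preTr.comp (add_zero 0) f g = 0 :=
    rfl
  have h₁ : T.preTr.one (T.preTrShift z 0) = shiftHom z z 0 0 0 (T.one z) :=
    preTr_one_shift z 0
  have h₂ (s : (T.hom z z).X (-1 + 0 - 0)) :
      (T.preTr.hom (T.preTrShift z 0) (T.preTrShift z 0)).dLin (-1) 0 (shiftHom z z 0 0 (-1) s) =
      shiftHom z z 0 0 0 ((T.hom z z).dLin (-1 + 0 - 0) 0 s) := by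
    refine (dLin_shiftHom (by lia) _).trans ?_
    rw [Int.negOnePow_zero, one_smul]
    rfl
  constructor
  · rintro ⟨f, g, _, _, _, t, ht⟩
    obtain ⟨s, rfl⟩ := (shiftHom z z 0 0 (-1)).surjective t
    rw [h₀, zero_sub, h₁, h₂, ← map_neg, (shiftHom z z 0 0 0).injective.eq_iff] at ht
    exact ⟨-s, (map_neg _ _).trans (neg_eq_iff_eq_neg.2 ht.symm)⟩
  · rintro ⟨s, hs⟩
    refine ⟨fun i => i.elim0, fun _ j => j.elim0, funext fun i => i.elim0,
      funext fun _ => funext fun j => j.elim0, ⟨fun i => i.elim0, funext fun i => i.elim0⟩,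
      -shiftHom z z 0 0 (-1) s, ?_⟩
    refine (congrArg (fun x => x - _) (h₀ _ _)).trans ?_
    rw [h₁, map_neg, h₂, zero_sub]
    exact congrArg (fun x => -shiftHom z z 0 0 0 x) hs.symm

/-- `B` is a shift of `A` by `r`, i.e. a model of `A[r]` in `T`: there is a closed morphism `B ⟶ A`
of degree `r` which is invertible up to homotopy, with a closed inverse of degree `-r`. -/
def IsShift (T : DGCategory.{u, v, w} k) (A B : T.Obj) (r : ℤ) : Prop :=
  ∃ (a : (T.hom B A).X r) (b : (T.hom A B).X (-r)),
    (T.hom B A).dLin r (r + 1) a = 0 ∧ (T.hom A B).dLin (-r) (-r + 1) b = 0 ∧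
    (∃ s : (T.hom A A).X (-1),
      T.comp (by lia) a b - T.one A = (T.hom A A).dLin (-1) 0 s) ∧
    (∃ t : (T.hom B B).X (-1),
      T.comp (by lia) b a - T.one B = (T.hom B B).dLin (-1) 0 t)

/-- The definition of `IsShift` with flexible degrees, which are only propositionally equal to those
in the definition. -/
theorem isShift_iff {A B : T.Obj} {r p q p' q' n n' m m' : ℤ} (hp : p = r) (hq : p + q = n)
    (hq' : q + p = n') (hp' : p + 1 = p') (hqq' : q + 1 = q') (hn : 0 = n) (hn' : 0 = n')
    (hm : m + 1 = 0) (hm' : m' + 1 = 0) :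
    T.IsShift A B r ↔
    ∃ (a : (T.hom B A).X p) (b : (T.hom A B).X q),
    (T.hom B A).dLin p p' a = 0 ∧ (T.hom A B).dLin q q' b = 0 ∧
    (∃ s : (T.hom A A).X m,
      T.comp hq a b - (((T.hom A A).XIsoOfEq hn).hom).hom (T.one A) =
        (T.hom A A).dLin m n s) ∧
    (∃ t : (T.hom B B).X m',
      T.comp hq' b a - (((T.hom B B).XIsoOfEq hn').hom).hom (T.one B) =
        (T.hom B B).dLin m' n' t) := by
  subst hp hp' hqq' hn hn'
  obtain rfl : q = -p := by lia
  obtain rfl : m = -1 := by lia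
  obtain rfl : m' = -1 := by lia
  rfl

theorem exists_dLin_units_smul_iff {K : CochainComplex (ModuleCat.{v} k) ℤ} (ε : ℤˣ) (p q : ℤ)
    (x : K.X q) : (∃ s, x = ε • K.dLin p q s) ↔ ∃ s, x = K.dLin p q s := by
  rcases Int.units_eq_one_or ε with rfl | rfl
  · simp
  · refine ⟨fun ⟨s, h⟩ => ⟨-s, ?_⟩, fun ⟨s, h⟩ => ⟨-s, ?_⟩⟩ <;> simpa using h

theorem homotopic_shift_iff {A B : T.Obj} {r : ℤ} :
    T.preTr.Homotopic (T.preTrShift A r) (T.preTrShift B 0) ↔ T.IsShift A B r := by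
  rw [isShift_iff (by lia : 0 + r - 0 = r) (by lia : 0 + r - 0 + (0 + 0 - r) = 0 + r - r)
    (by lia : 0 + 0 - r + (0 + r - 0) = 0 + 0 - 0) (by lia : 0 + r - 0 + 1 = 1 + r - 0)
    (by lia : 0 + 0 - r + 1 = 1 + 0 - r) (by lia : 0 = 0 + r - r) (by lia)
    (by lia : -1 + r - r + 1 = 0) (by lia : -1 + 0 - 0 + 1 = 0), Homotopic,
    ← (shiftHom A B r 0 0).toEquiv.exists_congr_right, exists_comm,
    ← (shiftHom B A 0 r 0).toEquiv.exists_congr_right]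
  refine exists_congr fun a => exists_congr fun b => ?_
  rw [← and_assoc, and_comm (a := (T.preTr.hom _ _).dLin 0 1 _ = 0), and_assoc]
  refine and_congr ?_ (and_congr ?_ (and_congr ?_ ?_))
  · refine (Eq.congr_left (dLin_shiftHom (zero_add 1) _)).trans ?_
    rw [LinearEquiv.map_eq_zero_iff, smul_eq_zero_iff_eq]
  · refine (Eq.congr_left (dLin_shiftHom (zero_add 1) _)).trans ?_
    rw [LinearEquiv.map_eq_zero_iff, smul_eq_zero_iff_eq]
  · refine Iff.trans ?_ (exists_dLin_units_smul_iff r.negOnePow _ _ _)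
    rw [← (shiftHom A A r r (-1)).toEquiv.exists_congr_right]
    refine exists_congr fun s => ?_
    refine (Eq.congr (congrArg₂ (fun x y => x - y) (comp_shiftHom (zero_add 0) _ _)
      (preTr_one_shift A r)) (dLin_shiftHom (by lia : (-1 : ℤ) + 1 = 0) _)).trans ?_
    rw [← map_sub, (shiftHom A A r r 0).injective.eq_iff]
  · refine Iff.trans ?_ (exists_dLin_units_smul_iff (0 : ℤ).negOnePow _ _ _)
    rw [← (shiftHom B B 0 0 (-1)).toEquiv.exists_congr_right]
    refine exists_congr fun s => ?_
    refine (Eq.congr (congrArg₂ (fun x y => x - y) (comp_shiftHom (zero_add 0) _ _)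
      (preTr_one_shift B 0)) (dLin_shiftHom (by lia : (-1 : ℤ) + 1 = 0) _)).trans ?_
    rw [← map_sub, (shiftHom B B 0 0 0).injective.eq_iff]

/-! ### Cones in `T^{pre-tr}` -/

section

variable {A B : T.Obj} {f : (T.hom A B).X 0} (hf : (T.hom A B).dLin 0 1 f = 0) (C : T.Obj)

theorem comp_zero_left {x y z : T.Obj} {p q n : ℤ} (h : p + q = n) (g : (T.hom x y).X q) :
    T.comp h (0 : (T.hom y z).X p) g = 0 := by
  rw [map_zero, LinearMap.zero_apply]

theorem comp_zero_right {x y z : T.Obj} {p q n : ℤ} (h : p + q = n) (g : (T.hom y z).X p) :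
    T.comp h g (0 : (T.hom x y).X q) = 0 :=
  map_zero _

theorem one_negOnePow_smul {V : Type*} [AddCommGroup V] (x : V) :
    (1 : ℤ).negOnePow • x = -x := by
  rw [Int.negOnePow_one, Units.neg_smul, one_smul]

theorem sum_two_left {V : Type*} [AddCommGroup V] {g : Fin 2 → V} (h : g 1 = 0) :
    ∑ r, g r = g 0 := by
  rw [Fin.sum_univ_two, h, add_zero]

theorem sum_two_right {V : Type*} [AddCommGroup V] {g : Fin 2 → V} (h : g 0 = 0) :
    ∑ r, g r = g 1 := by
  rw [Fin.sum_univ_two, h, zero_add]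

theorem sum_two_zero {V : Type*} [AddCommGroup V] {g : Fin 2 → V} (h₀ : g 0 = 0) (h₁ : g 1 = 0) :
    ∑ r, g r = 0 := by
  rw [sum_two_left h₁, h₀]

/-! An entry of the differential of a matrix has the form `a + b - ε • c`, where `b` and `c` are the
contributions of the matrices `q` of the target and of the source. -/

section

variable {V : Type*} [AddCommGroup V] {ε : ℤˣ} {a a' b b' c c' : V}

theorem entry_add_sub (ha : a = a') (hb : b = b') (hc : c = c') :
    a + b - ε • c = a' + b' - ε • c' := by
  rw [ha, hb, hc]

theorem entry_sub (ha : a = a') (hb : b = 0) (hc : c = c') : a + b - ε • c = a' - ε • c' := by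
  rw [ha, hb, hc, add_zero]

theorem entry_add (ha : a = a') (hb : b = b') (hc : c = 0) : a + b - ε • c = a' + b' := by
  rw [ha, hb, hc, smul_zero, sub_zero]

theorem entry_self (ha : a = a') (hb : b = 0) (hc : c = 0) : a + b - ε • c = a' := by
  rw [entry_add ha hb hc, add_zero]

end

/-- The morphisms of degree `l` from `cone(f)` to `C`: the entries are those from `A[1]` and from
`B`. -/
def fromCone (l : ℤ) : ((T.hom A C).X (l + 0 - 1) × (T.hom B C).X (l + 0 - 0)) ≃ₗ[k]
    (T.preTr.hom (T.preTrCone f hf) (T.preTrShift C 0)).X l where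
  toFun x
    | (0 : Fin 2), (0 : Fin 1) => x.1
    | (1 : Fin 2), (0 : Fin 1) => x.2
  invFun g := ((g : FormalSum.Matrices _ _ _) (0 : Fin 2) (0 : Fin 1),
    (g : FormalSum.Matrices _ _ _) (1 : Fin 2) (0 : Fin 1))
  map_add' _ _ := by
    funext i j
    match i, j with
    | (0 : Fin 2), (0 : Fin 1) => rfl
    | (1 : Fin 2), (0 : Fin 1) => rfl
  map_smul' _ _ := by
    funext i j
    match i, j with
    | (0 : Fin 2), (0 : Fin 1) => rfl
    | (1 : Fin 2), (0 : Fin 1) => rfl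
  left_inv _ := rfl
  right_inv _ := by
    funext i j
    match i, j with
    | (0 : Fin 2), (0 : Fin 1) => rfl
    | (1 : Fin 2), (0 : Fin 1) => rfl

/-- The morphisms of degree `l` from `C` to `cone(f)`: the entries are those to `A[1]` and to
`B`. -/
def toCone (l : ℤ) : ((T.hom C A).X (l + 1 - 0) × (T.hom C B).X (l + 0 - 0)) ≃ₗ[k]
    (T.preTr.hom (T.preTrShift C 0) (T.preTrCone f hf)).X l where
  toFun x
    | (0 : Fin 1), (0 : Fin 2) => x.1
    | (0 : Fin 1), (1 : Fin 2) => x.2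
  invFun g := ((g : FormalSum.Matrices _ _ _) (0 : Fin 1) (0 : Fin 2),
    (g : FormalSum.Matrices _ _ _) (0 : Fin 1) (1 : Fin 2))
  map_add' _ _ := by
    funext i j
    match i, j with
    | (0 : Fin 1), (0 : Fin 2) => rfl
    | (0 : Fin 1), (1 : Fin 2) => rfl
  map_smul' _ _ := by
    funext i j
    match i, j with
    | (0 : Fin 1), (0 : Fin 2) => rfl
    | (0 : Fin 1), (1 : Fin 2) => rfl
  left_inv _ := rfl
  right_inv _ := by
    funext i j
    match i, j with
    | (0 : Fin 1), (0 : Fin 2) => rfl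
    | (0 : Fin 1), (1 : Fin 2) => rfl

/-- The endomorphisms of degree `l` of `cone(f)`: the entries are those from `A[1]` to `A[1]`, from
`A[1]` to `B`, from `B` to `A[1]` and from `B` to `B`. -/
def coneEnd (l : ℤ) : (((T.hom A A).X (l + 1 - 1) × (T.hom A B).X (l + 0 - 1)) ×
      ((T.hom B A).X (l + 1 - 0) × (T.hom B B).X (l + 0 - 0))) ≃ₗ[k]
    (T.preTr.hom (T.preTrCone f hf) (T.preTrCone f hf)).X l where
  toFun x
    | (0 : Fin 2), (0 : Fin 2) => x.1.1
    | (0 : Fin 2), (1 : Fin 2) => x.1.2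
    | (1 : Fin 2), (0 : Fin 2) => x.2.1
    | (1 : Fin 2), (1 : Fin 2) => x.2.2
  invFun g := (((g : FormalSum.Matrices _ _ _) (0 : Fin 2) (0 : Fin 2),
    (g : FormalSum.Matrices _ _ _) (0 : Fin 2) (1 : Fin 2)),
    ((g : FormalSum.Matrices _ _ _) (1 : Fin 2) (0 : Fin 2),
    (g : FormalSum.Matrices _ _ _) (1 : Fin 2) (1 : Fin 2)))
  map_add' _ _ := by
    funext i j
    match i, j with
    | (0 : Fin 2), (0 : Fin 2) => rfl
    | (0 : Fin 2), (1 : Fin 2) => rfl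
    | (1 : Fin 2), (0 : Fin 2) => rfl
    | (1 : Fin 2), (1 : Fin 2) => rfl
  map_smul' _ _ := by
    funext i j
    match i, j with
    | (0 : Fin 2), (0 : Fin 2) => rfl
    | (0 : Fin 2), (1 : Fin 2) => rfl
    | (1 : Fin 2), (0 : Fin 2) => rfl
    | (1 : Fin 2), (1 : Fin 2) => rfl
  left_inv _ := rfl
  right_inv _ := by
    funext i j
    match i, j with
    | (0 : Fin 2), (0 : Fin 2) => rfl
    | (0 : Fin 2), (1 : Fin 2) => rfl
    | (1 : Fin 2), (0 : Fin 2) => rfl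
    | (1 : Fin 2), (1 : Fin 2) => rfl

theorem dLin_fromCone {l m : ℤ} (h : l + 1 = m)
    (x : (T.hom A C).X (l + 0 - 1) × (T.hom B C).X (l + 0 - 0)) :
    (T.preTr.hom (T.preTrCone f hf) (T.preTrShift C 0)).dLin l m (fromCone hf C l x) =
      fromCone hf C m ((T.hom A C).dLin _ _ x.1 - l.negOnePow • T.comp (by lia) x.2 f,
        (T.hom B C).dLin _ _ x.2) := by
  funext i j
  refine (preTr_dLin_apply (T.preTrCone f hf) (T.preTrShift C 0) h _ i j).trans ?_
  match i, j with
  | (0 : Fin 2), (0 : Fin 1) =>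
    exact entry_sub (one_smul _ _)
      ((Fin.sum_univ_one _).trans (comp_zero_left _ _))
      (sum_two_right (comp_zero_right _ _))
  | (1 : Fin 2), (0 : Fin 1) =>
    exact entry_self (one_smul _ _)
      ((Fin.sum_univ_one _).trans (comp_zero_left _ _))
      (sum_two_zero (comp_zero_right _ _) (comp_zero_right _ _))

theorem dLin_toCone {l m : ℤ} (h : l + 1 = m)
    (x : (T.hom C A).X (l + 1 - 0) × (T.hom C B).X (l + 0 - 0)) :
    (T.preTr.hom (T.preTrShift C 0) (T.preTrCone f hf)).dLin l m (toCone hf C l x) =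
      toCone hf C m (-(T.hom C A).dLin _ _ x.1,
        (T.hom C B).dLin _ _ x.2 + T.comp (by lia) f x.1) := by
  funext i j
  refine (preTr_dLin_apply (T.preTrShift C 0) (T.preTrCone f hf) h _ i j).trans ?_
  match i, j with
  | (0 : Fin 1), (0 : Fin 2) =>
    exact entry_self (one_negOnePow_smul _)
      (sum_two_zero (comp_zero_left _ _) (comp_zero_left _ _))
      ((Fin.sum_univ_one _).trans (comp_zero_right _ _))
  | (0 : Fin 1), (1 : Fin 2) =>
    exact entry_add (one_smul _ _)
      (sum_two_left (comp_zero_left _ _))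
      ((Fin.sum_univ_one _).trans (comp_zero_right _ _))

theorem dLin_coneEnd {l m : ℤ} (h : l + 1 = m)
    (x : ((T.hom A A).X (l + 1 - 1) × (T.hom A B).X (l + 0 - 1)) ×
      ((T.hom B A).X (l + 1 - 0) × (T.hom B B).X (l + 0 - 0))) :
    (T.preTr.hom (T.preTrCone f hf) (T.preTrCone f hf)).dLin l m (coneEnd hf l x) =
      coneEnd hf m
        ((-(T.hom A A).dLin _ _ x.1.1 - l.negOnePow • T.comp (by lia) x.2.1 f,
          (T.hom A B).dLin _ _ x.1.2 + T.comp (by lia) f x.1.1 -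
            l.negOnePow • T.comp (by lia) x.2.2 f),
        (-(T.hom B A).dLin _ _ x.2.1, (T.hom B B).dLin _ _ x.2.2 + T.comp (by lia) f x.2.1)) := by
  funext i j
  refine (preTr_dLin_apply (T.preTrCone f hf) (T.preTrCone f hf) h _ i j).trans ?_
  match i, j with
  | (0 : Fin 2), (0 : Fin 2) =>
    exact entry_sub (one_negOnePow_smul _)
      (sum_two_zero (comp_zero_left _ _) (comp_zero_left _ _))
      (sum_two_right (comp_zero_right _ _))
  | (0 : Fin 2), (1 : Fin 2) =>
    exact entry_add_sub (one_smul _ _)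
      (sum_two_left (comp_zero_left _ _))
      (sum_two_right (comp_zero_right _ _))
  | (1 : Fin 2), (0 : Fin 2) =>
    exact entry_self (one_negOnePow_smul _)
      (sum_two_zero (comp_zero_left _ _) (comp_zero_left _ _))
      (sum_two_zero (comp_zero_right _ _) (comp_zero_right _ _))
  | (1 : Fin 2), (1 : Fin 2) =>
    exact entry_add (one_smul _ _)
      (sum_two_left (comp_zero_left _ _))
      (sum_two_zero (comp_zero_right _ _) (comp_zero_right _ _))

theorem comp_fromCone_toCone {p q n : ℤ} (h : p + q = n)
    (x : (T.hom A C).X (p + 0 - 1) × (T.hom B C).X (p + 0 - 0))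
    (y : (T.hom C A).X (q + 1 - 0) × (T.hom C B).X (q + 0 - 0)) :
    T.preTr.comp h (fromCone hf C p x) (toCone hf C q y) =
      shiftHom C C 0 0 n (T.comp (by lia) x.1 y.1 + T.comp (by lia) x.2 y.2) := by
  funext i j
  refine (FormalSum.matrixComp_apply (T.preTrShift C 0).obj (T.preTrCone f hf).obj
    (T.preTrShift C 0).obj h _ _ i j).trans ((Fin.sum_univ_two _).trans ?_)
  match i, j with
  | (0 : Fin 1), (0 : Fin 1) => rfl

theorem comp_toCone_fromCone {p q n : ℤ} (h : p + q = n)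
    (x : (T.hom C A).X (p + 1 - 0) × (T.hom C B).X (p + 0 - 0))
    (y : (T.hom A C).X (q + 0 - 1) × (T.hom B C).X (q + 0 - 0)) :
    T.preTr.comp h (toCone hf C p x) (fromCone hf C q y) =
      coneEnd hf n ((T.comp (by lia) x.1 y.1, T.comp (by lia) x.2 y.1),
        (T.comp (by lia) x.1 y.2, T.comp (by lia) x.2 y.2)) := by
  funext i j
  refine (FormalSum.matrixComp_apply (T.preTrCone f hf).obj (T.preTrShift C 0).obj
    (T.preTrCone f hf).obj h _ _ i j).trans ((Fin.sum_univ_one _).trans ?_)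
  match i, j with
  | (0 : Fin 2), (0 : Fin 2) => rfl
  | (0 : Fin 2), (1 : Fin 2) => rfl
  | (1 : Fin 2), (0 : Fin 2) => rfl
  | (1 : Fin 2), (1 : Fin 2) => rfl

theorem preTr_one_cone :
    T.preTr.one (T.preTrCone f hf) = coneEnd hf 0 ((T.one A, 0), (0, T.one B)) := by
  funext i j
  match i, j with
  | (0 : Fin 2), (0 : Fin 2) => rfl
  | (0 : Fin 2), (1 : Fin 2) => rfl
  | (1 : Fin 2), (0 : Fin 2) => rfl
  | (1 : Fin 2), (1 : Fin 2) => rfl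

end

/-- `C` is a cone of `f : A ⟶ B`, i.e. a model of `cone(f)` in `T`: there are closed morphisms
`(γ, δ) : cone(f) ⟶ C` and `(α, β) : C ⟶ cone(f)` of degree `0` which are inverse to each other up
to homotopies `t` and `s`. Everything is written in terms of the entries in `T`; in particular
`γ : A ⟶ C` and `α : C ⟶ A` have degree `-1` and `1`. The matrix `t` of degree `-1` has entries
`t₁₁ : A ⟶ A`, `t₁₂ : A ⟶ B`, `t₂₁ : B ⟶ A` and `t₂₂ : B ⟶ B`. -/
def IsCone (T : DGCategory.{u, v, w} k) {A B : T.Obj} (f : (T.hom A B).X 0) (C : T.Obj) : Prop :=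
  ∃ (γ : (T.hom A C).X (-1)) (δ : (T.hom B C).X 0) (α : (T.hom C A).X 1) (β : (T.hom C B).X 0),
    ((T.hom A C).dLin (-1) 0 γ = T.comp (add_zero 0) δ f ∧ (T.hom B C).dLin 0 1 δ = 0) ∧
    ((T.hom C A).dLin 1 2 α = 0 ∧ (T.hom C B).dLin 0 1 β = -T.comp (by lia) f α) ∧
    (∃ (t₁₁ : (T.hom A A).X (-1)) (t₁₂ : (T.hom A B).X (-2)) (t₂₁ : (T.hom B A).X 0)
      (t₂₂ : (T.hom B B).X (-1)),
      (T.comp (by lia) α γ - T.one A =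
        -(T.hom A A).dLin (-1) 0 t₁₁ + T.comp (add_zero 0) t₂₁ f ∧
      T.comp (by lia) β γ = (T.hom A B).dLin (-2) (-1) t₁₂ + T.comp (by lia) f t₁₁ +
        T.comp (by lia) t₂₂ f) ∧
      T.comp (by lia) α δ = -(T.hom B A).dLin 0 1 t₂₁ ∧
      T.comp (by lia) β δ - T.one B =
        (T.hom B B).dLin (-1) 0 t₂₂ + T.comp (by lia) f t₂₁) ∧
    (∃ s : (T.hom C C).X (-1),
      T.comp (by lia) γ α + T.comp (add_zero 0) δ β - T.one C = (T.hom C C).dLin (-1) 0 s)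

theorem homotopic_cone_iff {A B C : T.Obj} {f : (T.hom A B).X 0}
    (hf : (T.hom A B).dLin 0 1 f = 0) :
    T.preTr.Homotopic (T.preTrCone f hf) (T.preTrShift C 0) ↔ T.IsCone f C := by
  rw [Homotopic, ← (fromCone hf C 0).toEquiv.exists_congr_right, Prod.exists]
  refine exists_congr fun γ => exists_congr fun δ => ?_
  rw [← (toCone hf C 0).toEquiv.exists_congr_right, Prod.exists]
  refine exists_congr fun α => exists_congr fun β => ?_
  refine and_congr ?_ (and_congr ?_ (and_congr ?_ ?_))
  · refine (Eq.congr_left (dLin_fromCone hf C (zero_add 1) _)).trans ?_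
    rw [LinearEquiv.map_eq_zero_iff, Prod.mk_eq_zero, Int.negOnePow_zero, one_smul, sub_eq_zero]
    rfl
  · refine (Eq.congr_left (dLin_toCone hf C (zero_add 1) _)).trans ?_
    rw [LinearEquiv.map_eq_zero_iff, Prod.mk_eq_zero, neg_eq_zero, add_eq_zero_iff_eq_neg]
    rfl
  · rw [← (coneEnd hf (-1)).toEquiv.exists_congr_right, Prod.exists, Prod.exists]
    refine exists_congr fun t₁₁ => exists_congr fun t₁₂ => ?_
    rw [Prod.exists]
    refine exists_congr fun t₂₁ => exists_congr fun t₂₂ => ?_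
    refine (Eq.congr (congrArg₂ (fun x y => x - y) (comp_toCone_fromCone hf C (zero_add 0) _ _)
      (preTr_one_cone hf)) (dLin_coneEnd hf (by lia : (-1 : ℤ) + 1 = 0) _)).trans ?_
    rw [← map_sub, (coneEnd hf 0).injective.eq_iff, Int.negOnePow_neg, Int.negOnePow_one]
    simp only [Units.neg_smul, one_smul, sub_neg_eq_add, Prod.mk_sub_mk, sub_zero, Prod.mk.injEq]
    rfl
  · rw [← (shiftHom C C 0 0 (-1)).toEquiv.exists_congr_right]
    refine exists_congr fun s => ?_
    refine (Eq.congr (congrArg₂ (fun x y => x - y) (comp_fromCone_toCone hf C (zero_add 0) _ _)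
      (preTr_one_shift C 0)) (dLin_shiftHom (by lia : (-1 : ℤ) + 1 = 0) _)).trans ?_
    rw [← map_sub, (shiftHom C C 0 0 0).injective.eq_iff, Int.negOnePow_zero, one_smul]
    rfl

/-- The definition of Bondal and Kapranov in terms of elements of the Hom complexes of `T`. -/
theorem isPretriangulatedBK_iff :
    T.IsPretriangulatedBK ↔
      (∃ (z : T.Obj) (s : (T.hom z z).X (-1)), (T.hom z z).dLin (-1) 0 s = T.one z) ∧
      (∀ (A : T.Obj) (r : ℤ), ∃ B, T.IsShift A B r) ∧
      (∀ (A B : T.Obj) (f : (T.hom A B).X 0), (T.hom A B).dLin 0 1 f = 0 →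
        ∃ C, T.IsCone f C) := by
  rw [← isHomotopicToObject_zero_iff]
  simp only [← homotopic_shift_iff]
  constructor
  · intro h
    exact ⟨h.zero, h.shift, fun A B f hf =>
      (h.cone f hf).imp fun C => (homotopic_cone_iff hf).1⟩
  · rintro ⟨h₀, h₁, h₂⟩
    exact ⟨h₀, h₁, fun f hf => (h₂ _ _ f hf).imp fun C => (homotopic_cone_iff hf).2⟩

namespace Mod

/-! ### Functoriality of the homotopy cofiber -/

section

variable {M' N' M N : T.Mod} (φ' : Hom M' N') (φ : Hom M N) (m : Hom M' M) (n : Hom N' N)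

/-- The element of degree `i` of the cone of a map of modules `M ⟶ N` with components `a`, of degree
`i + 1` in `M`, and `b`, of degree `i` in `N`. -/
noncomputable def conePair {x : T.Obj} {i j : ℤ} (h : i + 1 = j) (a : (M.obj x).X j)
    (b : (N.obj x).X i) : (mappingCone (φ.app x)).X i :=
  coneInl (φ.app x) i ((((M.obj x).XIsoOfEq h).inv).hom a) + coneInr (φ.app x) i b

theorem coneFst_conePair {x : T.Obj} {i : ℤ} (a : (M.obj x).X (i + 1)) (b : (N.obj x).X i) :
    coneFst (φ.app x) i (conePair φ rfl a b) = a := by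
  rw [conePair, map_add, coneFst_coneInl, coneFst_coneInr, add_zero]
  rfl

theorem coneSnd_conePair {x : T.Obj} {i : ℤ} (a : (M.obj x).X (i + 1)) (b : (N.obj x).X i) :
    coneSnd (φ.app x) i (conePair φ rfl a b) = b := by
  rw [conePair, map_add, coneSnd_coneInl, coneSnd_coneInr, zero_add]

theorem dLin_conePair {x : T.Obj} {i j l : ℤ} (h : i + 1 = j) (h' : j + 1 = l)
    (a : (M.obj x).X j) (b : (N.obj x).X i) :
    (mappingCone (φ.app x)).dLin i j (conePair φ h a b) =
      conePair φ h' (-(M.obj x).dLin j l a)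
        (((φ.app x).f j).hom a + (N.obj x).dLin i j b) := by
  subst h h'
  apply cone_ext
  · rw [coneFst_d _ _ _ rfl, coneFst_conePair, coneFst_conePair]
  · rw [coneSnd_d _ _ _ rfl, coneFst_conePair, coneSnd_conePair, coneSnd_conePair]
    rfl

theorem conePair_act {x y : T.Obj} {i j p i' j' : ℤ} (h : i + 1 = j) (h' : i' + 1 = j')
    (hp : i + p = i') (a : (M.obj y).X j) (b : (N.obj y).X i) (f : (T.hom x y).X p) :
    (homotopyCofiber φ).act hp (conePair φ h a b) f =
      conePair φ h' (M.act (by lia) a f) (N.act hp b f) := by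
  subst h h'
  apply cone_ext
  · refine (coneFst_coneAct φ hp _ f).trans ?_
    rw [coneFst_conePair, coneFst_conePair]
  · refine (coneSnd_coneAct φ hp _ f).trans ?_
    rw [coneSnd_conePair, coneSnd_conePair]

theorem exists_eq_conePair {x : T.Obj} {i j : ℤ} (h : i + 1 = j)
    (c : (mappingCone (φ.app x)).X i) : ∃ a b, c = conePair φ h a b := by
  subst h
  refine ⟨coneFst _ _ c, coneSnd _ _ c, cone_ext _ _ ?_ ?_⟩
  · rw [coneFst_conePair]
  · rw [coneSnd_conePair]

theorem conePair_inj {x : T.Obj} {i j : ℤ} (h : i + 1 = j) {a a' : (M.obj x).X j}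
    {b b' : (N.obj x).X i} : conePair φ h a b = conePair φ h a' b' ↔ a = a' ∧ b = b' := by
  subst h
  refine ⟨fun e => ⟨?_, ?_⟩, fun e => by rw [e.1, e.2]⟩
  · rw [← coneFst_conePair φ a b, e, coneFst_conePair]
  · rw [← coneSnd_conePair φ a b, e, coneSnd_conePair]

theorem conePair_add {x : T.Obj} {i j : ℤ} (h : i + 1 = j) (a a' : (M.obj x).X j)
    (b b' : (N.obj x).X i) :
    conePair φ h a b + conePair φ h a' b' = conePair φ h (a + a') (b + b') := by
  simp only [conePair, map_add]
  abel

theorem conePair_zero {x : T.Obj} {i j : ℤ} (h : i + 1 = j) :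
    conePair φ h (0 : (M.obj x).X j) 0 = 0 := by
  simp only [conePair, map_zero, add_zero]

theorem conePair_eq_zero_iff {x : T.Obj} {i j : ℤ} (h : i + 1 = j) {a : (M.obj x).X j}
    {b : (N.obj x).X i} : conePair φ h a b = 0 ↔ a = 0 ∧ b = 0 := by
  rw [← conePair_zero φ h, conePair_inj]

/-- A homotopy from `φ ∘ m` to `n ∘ φ'`, in the square with sides `φ' : M' ⟶ N'`, `φ : M ⟶ N`,
`m : M' ⟶ M` and `n : N' ⟶ N`. It is a family of maps of degree `-1`, compatible with the
action. -/
structure SquareHomotopy where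
  s (x : T.Obj) {p q : ℤ} (h : p + 1 = q) : (M'.obj x).X q →ₗ[k] (N.obj x).X p
  comm (x : T.Obj) {p q r : ℤ} (hpq : p + 1 = q) (hqr : q + 1 = r) (a : (M'.obj x).X q) :
    ((n.app x).f q).hom (((φ'.app x).f q).hom a) = ((φ.app x).f q).hom (((m.app x).f q).hom a) +
      (N.obj x).dLin p q (s x hpq a) + s x hqr ((M'.obj x).dLin q r a)
  s_act {x y : T.Obj} {p q p' q' r : ℤ} (hpq : p + 1 = q) (hp : p + r = p') (hq : q + r = q')
    (a : (M'.obj y).X q) (f : (T.hom x y).X r) :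
    s x (by lia : p' + 1 = q') (M'.act hq a f) = N.act hp (s y hpq a) f

variable {φ' φ m n} (σ : SquareHomotopy φ' φ m n)

/-- The map of mapping cones induced by a square which commutes up to a homotopy, in one degree. -/
noncomputable def cofiberMapLin (x : T.Obj) (i : ℤ) :
    (mappingCone (φ'.app x)).X i →ₗ[k] (mappingCone (φ.app x)).X i :=
  coneInl (φ.app x) i ∘ₗ ((m.app x).f (i + 1)).hom ∘ₗ coneFst (φ'.app x) i +
    coneInr (φ.app x) i ∘ₗ (((n.app x).f i).hom ∘ₗ coneSnd (φ'.app x) i +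
      σ.s x rfl ∘ₗ coneFst (φ'.app x) i)

theorem cofiberMapLin_conePair {x : T.Obj} {i j : ℤ} (h : i + 1 = j) (a : (M'.obj x).X j)
    (b : (N'.obj x).X i) :
    cofiberMapLin σ x i (conePair φ' h a b) =
      conePair φ h (((m.app x).f j).hom a) (((n.app x).f i).hom b + σ.s x h a) := by
  subst h
  refine (congrArg₂ (fun (a : (M'.obj x).X (i + 1)) (b : (N'.obj x).X i) =>
    coneInl (φ.app x) i (((m.app x).f (i + 1)).hom a) +
      coneInr (φ.app x) i (((n.app x).f i).hom b + σ.s x rfl a))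
    (coneFst_conePair φ' a b) (coneSnd_conePair φ' a b)).trans rfl

/-- The map of homotopy cofibers induced by a square of maps of modules which commutes up to
homotopy. -/
noncomputable def cofiberMap : Hom (homotopyCofiber φ') (homotopyCofiber φ) where
  app x :=
    { f i := ModuleCat.ofHom (cofiberMapLin σ x i)
      comm' i j h := ModuleCat.hom_ext <| LinearMap.ext fun c => by
        have h : i + 1 = j := h
        change (mappingCone (φ.app x)).dLin i j (cofiberMapLin σ x i c) =
          cofiberMapLin σ x j ((mappingCone (φ'.app x)).dLin i j c)
        obtain ⟨a, b, rfl⟩ := exists_eq_conePair φ' h c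
        rw [cofiberMapLin_conePair, dLin_conePair φ h rfl, dLin_conePair φ' h rfl,
          cofiberMapLin_conePair, conePair_inj]
        refine ⟨by rw [dLin_hom, map_neg], ?_⟩
        rw [map_add, map_add, map_neg, σ.comm x h rfl, dLin_hom]
        abel }
  app_act {x y p q i} h c f := by
    change cofiberMapLin σ x i ((homotopyCofiber φ').act h c f) =
      (homotopyCofiber φ).act h (cofiberMapLin σ y p c) f
    obtain ⟨a, b, rfl⟩ := exists_eq_conePair φ' rfl c
    rw [conePair_act φ' rfl rfl, cofiberMapLin_conePair, cofiberMapLin_conePair,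
      conePair_act φ rfl rfl, conePair_inj]
    refine ⟨m.app_act _ _ _, ?_⟩
    rw [n.app_act, map_add, LinearMap.add_apply, σ.s_act rfl h]

/-- The homotopy cofiber is invariant under weak equivalences. As in the five lemma, the components
in the source and in the target of the cone are lifted one after the other. -/
theorem cofiberMap_isWeakEquivalence (hm : m.IsWeakEquivalence) (hn : n.IsWeakEquivalence) :
    (cofiberMap σ).IsWeakEquivalence := by
  intro x
  refine quasiIso_of_exists_lift fun h i j l hhi hij hjl u y hu hy => ?_
  change cofiberMapLin σ x j u = (mappingCone (φ.app x)).dLin i j y at hy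
  obtain ⟨u₁, u₂, rfl⟩ := exists_eq_conePair φ' hjl u
  obtain ⟨y₁, y₂, rfl⟩ := exists_eq_conePair φ hij y
  replace hu := (conePair_eq_zero_iff φ' rfl).1 ((dLin_conePair φ' hjl rfl u₁ u₂).symm.trans hu)
  rw [neg_eq_zero] at hu
  rw [cofiberMapLin_conePair, dLin_conePair φ hij hjl, conePair_inj] at hy
  obtain ⟨hu₁, hu₂⟩ := hu
  obtain ⟨hy₁, hy₂⟩ := hy
  -- lift the first component along `m`
  obtain ⟨v, w, hv, hw⟩ := exists_lift_of_quasiIso (hm x) hij hjl rfl hu₁ (y := -y₁)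
    (by rw [hy₁, map_neg])
  have hc := σ.comm x hij hjl v
  rw [hv] at hc
  have hy₁' : y₁ = -(((m.app x).f j).hom v) - (M.obj x).dLin i j w := by
    rw [← neg_add', ← hw, neg_neg]
  have hφd : ((φ.app x).f j).hom ((M.obj x).dLin i j w) =
      (N.obj x).dLin i j (((φ.app x).f i).hom w) := (dLin_hom _ _ _ _).symm
  -- lift along `n` the second component, corrected by the choices of `v` and `w`
  obtain ⟨v', w', hv', hw'⟩ := exists_lift_of_quasiIso (hn x) hhi hij hjl
    (x := ((φ'.app x).f j).hom v + u₂) (by rw [map_add, dLin_hom, hv, hu₂])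
    (y := -((φ.app x).f i).hom w + σ.s x hij v + y₂) (by
      rw [map_add, hc, map_add, map_add, map_neg, ← hφd]
      have e : ((n.app x).f j).hom u₂ = ((φ.app x).f j).hom y₁ + (N.obj x).dLin i j y₂ -
        σ.s x hjl u₁ := eq_sub_of_add_eq hy₂
      rw [e, hy₁', map_sub, map_neg]
      abel)
  refine ⟨conePair φ' hij (-v) v', conePair φ hhi w w', ?_, ?_⟩
  · refine (dLin_conePair φ' hij hjl _ _).trans ?_
    rw [conePair_inj, map_neg, map_neg, neg_neg, hv, hv']
    exact ⟨rfl, neg_add_cancel_left _ _⟩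
  · refine Eq.trans ((conePair_inj φ hij).2 ⟨?_, ?_⟩) ((conePair_add φ hij _ _ _ _).symm.trans
      (congrArg₂ (· + ·) (cofiberMapLin_conePair σ hij _ _).symm
        (dLin_conePair φ hhi hij _ _).symm))
    · rw [hy₁', map_neg, sub_eq_add_neg]
    have e : y₂ = ((n.app x).f i).hom v' + (N.obj x).dLin h i w' + ((φ.app x).f i).hom w -
        σ.s x hij v := by
      rw [← hw']
      abel
    rw [e, map_neg]
    abel

end

end Mod

/-! ### Composition with closed morphisms -/

theorem d_comp_of_left {x y z : T.Obj} {p q n q' n' : ℤ} (h : p + q = n)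
    (hq : q + 1 = q') (hn : n + 1 = n') {g : (T.hom y z).X p}
    (hg : (T.hom y z).dLin p (p + 1) g = 0) (f : (T.hom x y).X q) :
    (T.hom x z).dLin n n' (T.comp h g f) =
      p.negOnePow • T.comp (by lia : p + q' = n') g ((T.hom x y).dLin q q' f) := by
  rw [T.d_comp h rfl hq hn, hg, comp_zero_left, zero_add]

theorem d_comp_of_right {x y z : T.Obj} {p q n p' n' : ℤ} (h : p + q = n)
    (hp : p + 1 = p') (hn : n + 1 = n') (g : (T.hom y z).X p) {f : (T.hom x y).X q}
    (hf : (T.hom x y).dLin q (q + 1) f = 0) :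
    (T.hom x z).dLin n n' (T.comp h g f) =
      T.comp (by lia : p' + q = n') ((T.hom y z).dLin p p' g) f := by
  rw [T.d_comp h hp rfl hn, hf, comp_zero_right, smul_zero, add_zero]

theorem comp_sub_left {x y z : T.Obj} {p q n : ℤ} (h : p + q = n) (g g' : (T.hom y z).X p)
    (f : (T.hom x y).X q) : T.comp h (g - g') f = T.comp h g f - T.comp h g' f := by
  rw [map_sub, LinearMap.sub_apply]

theorem comp_add_left {x y z : T.Obj} {p q n : ℤ} (h : p + q = n) (g g' : (T.hom y z).X p)
    (f : (T.hom x y).X q) : T.comp h (g + g') f = T.comp h g f + T.comp h g' f := by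
  rw [map_add, LinearMap.add_apply]

theorem comp_neg_left {x y z : T.Obj} {p q n : ℤ} (h : p + q = n) (g : (T.hom y z).X p)
    (f : (T.hom x y).X q) : T.comp h (-g) f = -T.comp h g f := by
  rw [map_neg, LinearMap.neg_apply]

/-! ### Objects representing the zero module -/

/-- The constant module `0` is represented by `z` if and only if the identity of `z` is a boundary,
i.e. `T(-, z)` is contractible. -/
theorem Mod.represents_zero_iff {z : T.Obj} :
    (Mod.zero T).Represents z ↔
      ∃ s : (T.hom z z).X (-1), (T.hom z z).dLin (-1) 0 s = T.one z := by
  constructor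
  · rintro ⟨m, hm, h⟩
    exact exists_dLin_eq_of_quasiIso (h z) (by lia : (-1 : ℤ) + 1 = 0) (zero_add 1)
      (x := T.one z) (T.d_one z) (y := 0) rfl
  · rintro ⟨s, hs⟩
    refine ⟨0, map_zero _, fun x => quasiIso_of_exists_lift
      fun h i j l _ hij hjl (u : (T.hom x z).X j) y (hu : (T.hom x z).dLin j l u = 0) _ =>
        ⟨T.comp (by lia : -1 + j = i) s u, 0, ?_, rfl⟩⟩
    subst hjl
    refine (d_comp_of_right (by lia) (by lia : (-1 : ℤ) + 1 = 0) hij s hu).trans ?_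
    rw [hs, T.one_comp]

/-! ### Composition and existence of shifts -/

namespace IsShift

theorem refl (A : T.Obj) : T.IsShift A A 0 :=
  ⟨T.one A, T.one A, T.d_one A, T.d_one A,
    ⟨0, (sub_eq_zero.2 (T.one_comp _)).trans (map_zero _).symm⟩,
    ⟨0, (sub_eq_zero.2 (T.one_comp _)).trans (map_zero _).symm⟩⟩

theorem trans {A B C : T.Obj} {r r' : ℤ} (h : T.IsShift A B r) (h' : T.IsShift B C r') :
    T.IsShift A C (r + r') := by
  have key : ∀ {x y z : T.Obj} {p p' q q' pp qq : ℤ} (hp : p + q = 0) (hp' : p' + q' = 0)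
      (hpp : p + p' = pp) (hqq : q' + q = qq)
      (g : (T.hom y z).X p) (g' : (T.hom x y).X p') (f' : (T.hom y x).X q') (f : (T.hom z y).X q),
      (T.hom y z).dLin p (p + 1) g = 0 → (T.hom z y).dLin q (q + 1) f = 0 →
      (∃ s, T.comp hp g f - T.one z = (T.hom z z).dLin (-1) 0 s) →
      (∃ s, T.comp hp' g' f' - T.one y = (T.hom y y).dLin (-1) 0 s) →
      ∃ s, T.comp (by lia : pp + qq = 0) (T.comp hpp g g') (T.comp hqq f' f) - T.one z =
        (T.hom z z).dLin (-1) 0 s := by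
    -- `g g' f' f` is homotopic to `g f` through `± g s' f`, hence to the identity
    rintro x y z p p' q q' pp qq hp hp' hpp hqq g g' f' f hg hf ⟨s, hs⟩ ⟨s', hs'⟩
    have e₁ := d_comp_of_right (by lia : -1 + q = -1 + q) (by lia : (-1 : ℤ) + 1 = 0)
      (by lia : -1 + q + 1 = q) s' hf
    have e₂ := d_comp_of_left (by lia : p + (-1 + q) = -1) (by lia : -1 + q + 1 = q)
      (by lia : (-1 : ℤ) + 1 = 0) hg (T.comp (by lia : -1 + q = -1 + q) s' f)
    rw [e₁, ← hs', comp_sub_left, T.one_comp, map_sub, T.assoc hp' hqq (zero_add q),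
      ← T.assoc hpp (by lia : p' + qq = q) (by lia : pp + qq = 0)] at e₂
    refine ⟨s + p.negOnePow • T.comp (by lia : p + (-1 + q) = -1) g
      (T.comp (by lia : -1 + q = -1 + q) s' f), ?_⟩
    rw [map_add, ← hs, Units.smul_def, map_zsmul, e₂, ← Units.smul_def, smul_smul,
      Int.units_mul_self, one_smul]
    abel
  obtain ⟨a, b, ha, hb, hs, ht⟩ := h
  obtain ⟨a', b', ha', hb', hs', ht'⟩ := h'
  refine (isShift_iff rfl (by lia : r + r' + (-r' + -r) = 0) (by lia) rfl rfl rfl rfl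
    (by lia : (-1 : ℤ) + 1 = 0) (by lia : (-1 : ℤ) + 1 = 0)).2
    ⟨T.comp rfl a a', T.comp rfl b' b, ?_, ?_, ?_, ?_⟩
  · rw [d_comp_of_left rfl rfl rfl ha, ha', comp_zero_right, smul_zero]
  · rw [d_comp_of_left rfl rfl rfl hb', hb, comp_zero_right, smul_zero]
  · exact key _ _ _ _ a a' b' b ha hb hs hs'
  · exact key _ _ _ _ b' b a a' hb' ha' ht' ht

end IsShift

theorem exists_isShift_of_one_of_neg_one (h : ∀ A : T.Obj, ∃ B, T.IsShift A B 1)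
    (h' : ∀ A : T.Obj, ∃ B, T.IsShift A B (-1)) (A : T.Obj) (r : ℤ) : ∃ B, T.IsShift A B r := by
  induction r with
  | zero => exact ⟨A, .refl A⟩
  | succ n ih =>
    obtain ⟨B, hB⟩ := ih
    obtain ⟨C, hC⟩ := h B
    exact ⟨C, hB.trans hC⟩
  | pred n ih =>
    obtain ⟨B, hB⟩ := ih
    obtain ⟨C, hC⟩ := h' B
    exact ⟨C, hB.trans hC⟩

/-- A closed morphism `a` of degree `r` is invertible up to homotopy if composition with `a` is a
quasi-isomorphism: surjectivity on cohomology gives a right inverse, which by injectivity is also a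
left inverse. -/
theorem isShift_of_exists {A B : T.Obj} {r q l : ℤ} (hq : r + q = 0) (hl : l + 1 = r)
    (a : (T.hom B A).X r) (ha : (T.hom B A).dLin r (r + 1) a = 0)
    (hsurj : ∃ (g : (T.hom A B).X q) (z : (T.hom A A).X (-1)),
      (T.hom A B).dLin q (q + 1) g = 0 ∧ T.one A = T.comp hq a g + (T.hom A A).dLin (-1) 0 z)
    (hinj : ∀ (u : (T.hom B B).X 0) (y : (T.hom B A).X l), (T.hom B B).dLin 0 1 u = 0 →
      T.comp (add_zero r) a u = (T.hom B A).dLin l r y →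
      ∃ s, (T.hom B B).dLin (-1) 0 s = u) :
    T.IsShift A B r := by
  obtain ⟨g, z, hg, hz⟩ := hsurj
  have hz' : T.comp hq a g = T.one A - (T.hom A A).dLin (-1) 0 z := eq_sub_of_add_eq hz.symm
  obtain ⟨s, hs⟩ := hinj (T.comp (by lia) g a - T.one B) (-T.comp (by lia) z a)
    (by rw [map_sub, d_comp_of_left _ (by lia : r + 1 = r + 1) _ hg, ha, T.d_one, comp_zero_right,
      smul_zero, sub_zero]; lia)
    (by
      rw [map_sub, T.comp_one, map_neg,
        d_comp_of_right (by lia) (by lia : (-1 : ℤ) + 1 = 0) hl z ha,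
        ← T.assoc hq (by lia) (zero_add r), hz', comp_sub_left,
        T.one_comp, sub_sub_cancel_left])
  exact (isShift_iff rfl hq (by lia : q + r = 0) rfl rfl rfl rfl (by lia : (-1 : ℤ) + 1 = 0)
    (by lia : (-1 : ℤ) + 1 = 0)).2 ⟨a, g, ha, hg, ⟨-z, by
      refine (congrArg (fun x => x - T.one A) hz').trans ?_
      rw [map_neg, sub_sub_cancel_left]⟩, ⟨s, hs.symm⟩⟩

namespace Mod

/-! ### Suspension and desuspension of modules -/

theorem suspension_dLin (M : T.Mod) (x : T.Obj) (i j : ℤ) (a : (M.obj x).X (i + 1)) :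
    (M.suspension.obj x).dLin i j a =
      (-(M.obj x).dLin (i + 1) (j + 1) a : (M.obj x).X (j + 1)) := by
  refine (congrArg (fun f => f.hom a) (shiftFunctor_obj_d' (M.obj x) 1 i j)).trans ?_
  simp [CochainComplex.dLin]
  rfl

/-- The map from a module to the constant module `0`. -/
def toZero (M : T.Mod) : Hom M (zero T) where
  app _ := 0
  app_act _ _ _ := rfl

/-- The projection from the homotopy cofiber of `M ⟶ 0` to the suspension of `M`. -/
noncomputable def cofiberToSuspension (M : T.Mod) :
    Hom (homotopyCofiber (toZero M)) M.suspension where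
  app x :=
    { f i := ModuleCat.ofHom (Y := M.obj x |>.X (i + 1)) (coneFst ((toZero M).app x) i)
      comm' i j h := ModuleCat.hom_ext <| LinearMap.ext fun c =>
        (suspension_dLin M x i j (coneFst ((toZero M).app x) i c)).trans
          (coneFst_d ((toZero M).app x) i j h c).symm }
  app_act h c f := coneFst_coneAct (toZero M) h c f

theorem cofiberToSuspension_isWeakEquivalence (M : T.Mod) :
    (cofiberToSuspension M).IsWeakEquivalence := by
  intro x
  refine quasiIso_of_exists_lift fun h i j l _ hij _
    (u : (mappingCone ((toZero M).app x)).X j) (y : (M.obj x).X (i + 1)) _ hy => ?_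
  subst hij
  refine ⟨conePair (toZero M) rfl y 0, 0, ?_, ?_⟩
  · refine cone_ext _ _ ((coneFst_d _ _ _ rfl _).trans ?_) rfl
    rw [coneFst_conePair]
    exact ((suspension_dLin M x i (i + 1) y).symm.trans hy.symm :)
  · rw [map_zero, add_zero]
    exact (coneFst_conePair (toZero M) y 0).symm

theorem shiftFunctor_neg_one_dLin (K : CochainComplex (ModuleCat.{v} k) ℤ) (i j : ℤ)
    (a : K.X (i + -1)) :
    ((CochainComplex.shiftFunctor (ModuleCat.{v} k) (-1)).obj K).dLin i j a =
      (-K.dLin (i + -1) (j + -1) a : K.X (j + -1)) := by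
  refine (congrArg (fun f => f.hom a) (shiftFunctor_obj_d' K (-1) i j)).trans ?_
  simp [CochainComplex.dLin]
  rfl

/-- The desuspension of a module: the pointwise shift by `-1`. -/
def desuspension (M : T.Mod) : T.Mod where
  obj x := (CochainComplex.shiftFunctor (ModuleCat.{v} k) (-1)).obj (M.obj x)
  act {_ _ p q n} h := M.act (by lia : (p + -1) + q = n + -1)
  d_act {x y p q n p' q' n'} h hp hq hn m f := by
    have key := M.d_act (by lia : (p + -1) + q = n + -1) (by lia : (p + -1) + 1 = p' + -1) hq
      (by lia : (n + -1) + 1 = n' + -1) m f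
    have e := fun x => shiftFunctor_neg_one_dLin (M.obj x)
    refine (e _ _ _ _).trans (((congrArg Neg.neg key).trans ?_).trans
      (congrArg (fun z : (M.obj y).X (p' + -1) =>
        M.act (by lia : (p' + -1) + q = n' + -1) z f +
          p.negOnePow • M.act (by lia : (p + -1) + q' = n' + -1) m ((T.hom x y).dLin q q' f))
        (e _ _ _ _).symm))
    have hsgn : (p + -1).negOnePow = -p.negOnePow := by
      rw [Int.negOnePow_add, Int.negOnePow_neg, Int.negOnePow_one, mul_neg, mul_one]
    rw [hsgn, map_neg, LinearMap.neg_apply, neg_add, Units.neg_smul, neg_neg]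
  act_one {x p} m := M.act_one m
  act_act hpq hqr h m g f := M.act_act _ hqr _ m g f

/-- The module `ΣΣ⁻¹T(-, A)` is represented by `A`. Its terms are those of `T(-, A)` up to the
equality `i + 1 - 1 = i`, which is not definitional; composition with the identity of `A` serves as
the transport between the two. -/
theorem represents_suspension_desuspension (A : T.Obj) :
    (representable T A).desuspension.suspension.Represents A := by
  have hd (x : T.Obj) (i j : ℤ) (a : (T.hom x A).X (i + 1 + -1)) :
      ((representable T A).desuspension.suspension.obj x).dLin i j a =
        ((T.hom x A).dLin (i + 1 + -1) (j + 1 + -1) a : (T.hom x A).X (j + 1 + -1)) :=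
    (suspension_dLin (representable T A).desuspension x i j a).trans
      ((congrArg Neg.neg (shiftFunctor_neg_one_dLin (T.hom x A) (i + 1) (j + 1) a)).trans
        (neg_neg _))
  have hone {x : T.Obj} {p q : ℤ} (h : 0 + p = q) (h' : 0 + q = p) (y : (T.hom x A).X p) :
      T.comp h' (T.one A) (T.comp h (T.one A) y) = y := by
    obtain rfl : q = p := by lia
    rw [T.one_comp, T.one_comp]
  refine ⟨T.one A, (hd A 0 1 (T.one A)).trans (T.d_one A), fun x => quasiIso_of_exists_lift
    fun h i j l hhi hij hjl (u : (T.hom x A).X j) (y : (T.hom x A).X (i + 1 + -1)) hu hy =>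
      ⟨T.comp (by lia : 0 + (i + 1 + -1) = i) (T.one A) y, 0, ?_, ?_⟩⟩
  · have hy' : T.comp (by lia : 0 + j = j + 1 + -1) (T.one A) u =
        (T.hom x A).dLin (i + 1 + -1) (j + 1 + -1) y := hy.trans (hd x i j y)
    refine (d_comp_of_left (by lia) (by lia : i + 1 + -1 + 1 = j + 1 + -1) hij
      (T.d_one A) y).trans ?_
    rw [← hy', Int.negOnePow_zero, one_smul, hone]
  · rw [map_zero, add_zero]
    exact (hone _ _ y).symm

/-- An object representing `ΣT(-, A)` is a shift of `A` by `1`. -/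
theorem Represents.isShift_one {A B : T.Obj} (h : (representable T A).suspension.Represents B) :
    T.IsShift A B 1 := by
  obtain ⟨(a : (T.hom B A).X (0 + 1)), ha, h⟩ := h
  have ha' : (T.hom B A).dLin 1 2 a = 0 :=
    neg_eq_zero.1 ((suspension_dLin (representable T A) B 0 1 a).symm.trans ha)
  have hd (o : (T.hom A A).X (-1 + 1)) (ho : (T.hom A A).dLin (-1 + 1) (0 + 1) o = 0) :
      ((representable T A).suspension.obj A).dLin (-1) 0 o = 0 :=
    (suspension_dLin (representable T A) A (-1) 0 o).trans (neg_eq_zero.2 ho)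
  refine isShift_of_exists (by lia : (1 : ℤ) + -1 = 0) (zero_add 1) a ha' ?_ ?_
  · obtain ⟨g, z, hg, hz⟩ := exists_eq_add_dLin_of_quasiIso (h A) (by lia : (-2 : ℤ) + 1 = -1)
      (by lia : (-1 : ℤ) + 1 = 0) (y := (T.one A : (T.hom A A).X (-1 + 1)))
      (hd (T.one A) (T.d_one A))
    refine ⟨g, (-z : (T.hom A A).X (-2 + 1)), hg, hz.trans (congrArg (fun y => _ + y) ?_)⟩
    exact (suspension_dLin (representable T A) A (-2) (-1) z).trans (map_neg _ _).symm
  · intro u y hu hy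
    refine exists_dLin_eq_of_quasiIso (h B) (by lia : (-1 : ℤ) + 1 = 0) (zero_add 1) hu
      (y := (-y : (T.hom B A).X (-1 + 1))) (hy.trans ?_)
    exact ((suspension_dLin (representable T A) B (-1) 0 (-y)).trans
      ((congrArg Neg.neg (map_neg _ _)).trans (neg_neg _))).symm

/-- An object representing `Σ⁻¹T(-, A)` is a shift of `A` by `-1`. -/
theorem Represents.isShift_neg_one {A B : T.Obj}
    (h : (representable T A).desuspension.Represents B) : T.IsShift A B (-1) := by
  obtain ⟨(a : (T.hom B A).X (0 + -1)), ha, h⟩ := h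
  have ha' : (T.hom B A).dLin (-1) 0 a = 0 :=
    neg_eq_zero.1 ((shiftFunctor_neg_one_dLin (T.hom B A) 0 1 a).symm.trans ha)
  refine isShift_of_exists (by lia : (-1 : ℤ) + 1 = 0) (by lia : (-2 : ℤ) + 1 = -1) a ha' ?_ ?_
  · obtain ⟨g, z, hg, hz⟩ := exists_eq_add_dLin_of_quasiIso (h A) (zero_add 1)
      (by lia : (1 : ℤ) + 1 = 2) (y := (T.one A : (T.hom A A).X (1 + -1)))
      ((shiftFunctor_neg_one_dLin (T.hom A A) 1 2 (T.one A)).trans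
        (neg_eq_zero.2 (T.d_one A)))
    refine ⟨g, (-z : (T.hom A A).X (0 + -1)), hg, hz.trans (congrArg (fun y => _ + y) ?_)⟩
    exact (shiftFunctor_neg_one_dLin (T.hom A A) 0 1 z).trans (map_neg _ _).symm
  · intro u y hu hy
    refine exists_dLin_eq_of_quasiIso (h B) (by lia : (-1 : ℤ) + 1 = 0) (zero_add 1) hu
      (y := (-y : (T.hom B A).X (-1 + -1))) (hy.trans ?_)
    exact ((shiftFunctor_neg_one_dLin (T.hom B A) (-1) 0 (-y)).trans
      ((congrArg Neg.neg (map_neg _ _)).trans (neg_neg _))).symm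

/-! ### Cones and homotopy cofibers of maps of representable modules -/

section

variable {A B C : T.Obj} {f : (T.hom A B).X 0} (hf : (T.hom A B).dLin 0 1 f = 0)

/-- The map of representable modules given by composition with a closed morphism of degree `0`. -/
def representableMap (f : (T.hom A B).X 0) (hf : (T.hom A B).dLin 0 1 f = 0) :
    Hom (representable T A) (representable T B) :=
  yoneda (representable T B) f hf

theorem dLin_conePair_representableMap {x : T.Obj} {i j l : ℤ} (h : i + 1 = j) (h' : j + 1 = l)
    (a : (T.hom x A).X j) (b : (T.hom x B).X i) :
    ((homotopyCofiber (representableMap f hf)).obj x).dLin i j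
        (conePair (representableMap f hf) h a b) =
      conePair (representableMap f hf) (x := x) h' (-(T.hom x A).dLin j l a)
        (T.comp (zero_add j) f a + (T.hom x B).dLin i j b) :=
  dLin_conePair (representableMap f hf) h h' a b

theorem conePair_representableMap_act {x y : T.Obj} {i j p i' j' : ℤ} (h : i + 1 = j)
    (h' : i' + 1 = j') (hp : i + p = i') (a : (T.hom y A).X j) (b : (T.hom y B).X i)
    (g : (T.hom x y).X p) :
    (homotopyCofiber (representableMap f hf)).act hp
        (conePair (representableMap f hf) h a b) g =
      conePair (representableMap f hf) (x := x) h' (T.comp (by lia) a g) (T.comp hp b g) :=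
  conePair_act (representableMap f hf) h h' hp a b g

/-- The closed elements of degree `0` of the homotopy cofiber of `T(-, A) ⟶ T(-, B)` at `C` are the
closed morphisms `(α, β) : C ⟶ cone(f)` of degree `0`. -/
theorem conePair_representableMap_closed {α : (T.hom C A).X 1} {β : (T.hom C B).X 0} :
    ((homotopyCofiber (representableMap f hf)).obj C).dLin 0 1
        (conePair (representableMap f hf) (zero_add 1) α β) = 0 ↔
      (T.hom C A).dLin 1 2 α = 0 ∧ (T.hom C B).dLin 0 1 β = -T.comp (by lia) f α := by
  refine (Eq.congr_left (dLin_conePair_representableMap hf (zero_add 1)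
    (by lia : (1 : ℤ) + 1 = 2) α β)).trans ((conePair_eq_zero_iff _ _).trans
      (and_congr neg_eq_zero add_eq_zero_iff_eq_neg'))

end

end Mod

open _root_.DGCategory.Mod

section

variable {A B C x : T.Obj} {f : (T.hom A B).X 0} {γ : (T.hom A C).X (-1)} {δ : (T.hom B C).X 0}
  {α : (T.hom C A).X 1} {β : (T.hom C B).X 0} {i : ℤ}

/-- Composition with `(α, β) : C ⟶ cone(f)` is injective on cohomology, because `(γ, δ)` is a left
inverse up to homotopy. -/
theorem exists_dLin_eq_of_cone {s : (T.hom C C).X (-1)}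
    (hγ : (T.hom A C).dLin (-1) 0 γ = T.comp (add_zero 0) δ f) (hδ : (T.hom B C).dLin 0 1 δ = 0)
    (hs : T.comp (by lia) γ α + T.comp (add_zero 0) δ β - T.one C = (T.hom C C).dLin (-1) 0 s)
    {u : (T.hom x C).X (i + 1)} (hu : (T.hom x C).dLin (i + 1) (i + 1 + 1) u = 0)
    {y₁ : (T.hom x A).X (i + 1)} {y₂ : (T.hom x B).X i}
    (hy₁ : T.comp (by lia) α u = -(T.hom x A).dLin (i + 1) (i + 1 + 1) y₁)
    (hy₂ : T.comp (by lia) β u = T.comp (by lia) f y₁ + (T.hom x B).dLin i (i + 1) y₂) :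
    ∃ u', (T.hom x C).dLin i (i + 1) u' = u := by
  refine ⟨T.comp (by lia : -1 + (i + 1) = i) γ y₁ + T.comp (zero_add i) δ y₂ -
    T.comp (by lia : -1 + (i + 1) = i) s u, ?_⟩
  have e₁ := T.d_comp (by lia : -1 + (i + 1) = i) (by lia : (-1 : ℤ) + 1 = 0) rfl rfl γ y₁
  have e₂ := d_comp_of_left (zero_add i) rfl rfl hδ y₂
  have e₃ := d_comp_of_right (by lia : -1 + (i + 1) = i) (by lia : (-1 : ℤ) + 1 = 0) rfl s hu
  have e₄ := congrArg (fun g => T.comp (zero_add (i + 1)) g u) hs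
  simp only [comp_sub_left, comp_add_left, T.one_comp] at e₄
  rw [T.assoc (by lia : (-1 : ℤ) + 1 = 0) (by lia : 1 + (i + 1) = i + 1 + 1),
    T.assoc (add_zero 0) (zero_add (i + 1)), hy₁, hy₂] at e₄
  rw [hγ, T.assoc (add_zero 0) (zero_add (i + 1))] at e₁
  rw [map_sub, map_add, e₁, e₂, e₃, ← e₄, map_neg, map_add, Int.negOnePow_neg,
    Int.negOnePow_one, Units.neg_smul, Int.negOnePow_zero, one_smul, one_smul]
  abel

variable {y₁ : (T.hom x A).X (i + 1 + 1)} {y₂ : (T.hom x B).X (i + 1)}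

/-- Composition with `(γ, δ) : cone(f) ⟶ C` sends cycles `(y₁, y₂)` to cycles. -/
theorem dLin_cone_eq_zero (hγ : (T.hom A C).dLin (-1) 0 γ = T.comp (add_zero 0) δ f)
    (hδ : (T.hom B C).dLin 0 1 δ = 0)
    (hy₁ : (T.hom x A).dLin (i + 1 + 1) (i + 1 + 1 + 1) y₁ = 0)
    (hy₂ : (T.hom x B).dLin (i + 1) (i + 1 + 1) y₂ = -T.comp (zero_add _) f y₁) :
    (T.hom x C).dLin (i + 1) (i + 1 + 1)
      (T.comp (by lia : -1 + (i + 1 + 1) = i + 1) γ y₁ + T.comp (zero_add _) δ y₂) = 0 := by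
  have e₁ := d_comp_of_right (by lia : -1 + (i + 1 + 1) = i + 1) (by lia : (-1 : ℤ) + 1 = 0)
    rfl γ hy₁
  have e₂ := d_comp_of_left (zero_add (i + 1)) rfl rfl hδ y₂
  rw [hγ, T.assoc (add_zero 0) (zero_add (i + 1 + 1))] at e₁
  rw [map_add, e₁, e₂, hy₂, map_neg, Int.negOnePow_zero, one_smul, add_neg_cancel]

/-- The first component of the identity expressing a cycle `(y₁, y₂)` as the image under `(α, β)` of
its image under `(γ, δ)`, up to a boundary given by the homotopy `t`. -/
theorem eq_comp_cone_fst {t₁₁ : (T.hom A A).X (-1)} {t₂₁ : (T.hom B A).X 0}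
    (h₁₁ : T.comp (by lia) α γ - T.one A =
      -(T.hom A A).dLin (-1) 0 t₁₁ + T.comp (add_zero 0) t₂₁ f)
    (h₂₁ : T.comp (by lia) α δ = -(T.hom B A).dLin 0 1 t₂₁)
    (hy₁ : (T.hom x A).dLin (i + 1 + 1) (i + 1 + 1 + 1) y₁ = 0)
    (hy₂ : (T.hom x B).dLin (i + 1) (i + 1 + 1) y₂ = -T.comp (zero_add _) f y₁) :
    y₁ = T.comp (by lia : 1 + (i + 1) = i + 1 + 1) α
        (T.comp (by lia : -1 + (i + 1 + 1) = i + 1) γ y₁ + T.comp (zero_add _) δ y₂) +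
      -(T.hom x A).dLin (i + 1) (i + 1 + 1)
        (-(T.comp (by lia : -1 + (i + 1 + 1) = i + 1) t₁₁ y₁ + T.comp (zero_add _) t₂₁ y₂)) := by
  have e₁ := congrArg (fun g => T.comp (zero_add (i + 1 + 1)) g y₁) h₁₁
  simp only [comp_sub_left, comp_add_left, comp_neg_left, T.one_comp] at e₁
  rw [T.assoc (by lia : (1 : ℤ) + -1 = 0) (by lia : -1 + (i + 1 + 1) = i + 1),
    T.assoc (add_zero 0) (zero_add (i + 1 + 1)), sub_eq_iff_eq_add] at e₁
  have e₂ := congrArg (fun g => T.comp (by lia : 1 + (i + 1) = i + 1 + 1) g y₂) h₂₁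
  simp only [comp_neg_left] at e₂
  rw [T.assoc (add_zero 1) (zero_add (i + 1))] at e₂
  have e₃ := d_comp_of_right (by lia : -1 + (i + 1 + 1) = i + 1)
    (by lia : (-1 : ℤ) + 1 = 0) rfl t₁₁ hy₁
  have e₄ := T.d_comp (zero_add (i + 1)) (zero_add 1) rfl rfl t₂₁ y₂
  rw [hy₂, map_neg, Int.negOnePow_zero, one_smul] at e₄
  rw [map_add, e₁, e₂, map_neg, map_add, e₃, e₄]
  abel

/-- The second component of the identity expressing a cycle `(y₁, y₂)` as the image under `(α, β)`
of its image under `(γ, δ)`, up to a boundary given by the homotopy `t`. -/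
theorem eq_comp_cone_snd {t₁₁ : (T.hom A A).X (-1)} {t₁₂ : (T.hom A B).X (-2)}
    {t₂₁ : (T.hom B A).X 0} {t₂₂ : (T.hom B B).X (-1)}
    (h₁₂ : T.comp (by lia) β γ = (T.hom A B).dLin (-2) (-1) t₁₂ + T.comp (by lia) f t₁₁ +
      T.comp (by lia) t₂₂ f)
    (h₂₂ : T.comp (by lia) β δ - T.one B =
      (T.hom B B).dLin (-1) 0 t₂₂ + T.comp (by lia) f t₂₁)
    (hy₁ : (T.hom x A).dLin (i + 1 + 1) (i + 1 + 1 + 1) y₁ = 0)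
    (hy₂ : (T.hom x B).dLin (i + 1) (i + 1 + 1) y₂ = -T.comp (zero_add _) f y₁) :
    y₂ = T.comp (zero_add (i + 1)) β
        (T.comp (by lia : -1 + (i + 1 + 1) = i + 1) γ y₁ + T.comp (zero_add _) δ y₂) +
      (T.comp (zero_add (i + 1)) f
        (-(T.comp (by lia : -1 + (i + 1 + 1) = i + 1) t₁₁ y₁ + T.comp (zero_add _) t₂₁ y₂)) +
      (T.hom x B).dLin i (i + 1) (-(T.comp (by lia : -2 + (i + 1 + 1) = i) t₁₂ y₁ +
        T.comp (by lia : -1 + (i + 1) = i) t₂₂ y₂))) := by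
  have e₁ := congrArg (fun g => T.comp (by lia : -1 + (i + 1 + 1) = i + 1) g y₁) h₁₂
  simp only [comp_add_left] at e₁
  rw [T.assoc (zero_add (-1)) (by lia : -1 + (i + 1 + 1) = i + 1),
    T.assoc (zero_add (-1)) (by lia : -1 + (i + 1 + 1) = i + 1),
    T.assoc (add_zero (-1)) (zero_add (i + 1 + 1))] at e₁
  have e₂ := congrArg (fun g => T.comp (zero_add (i + 1)) g y₂) h₂₂
  simp only [comp_sub_left, comp_add_left, T.one_comp] at e₂
  rw [T.assoc (add_zero 0) (zero_add (i + 1)), T.assoc (add_zero 0) (zero_add (i + 1)),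
    sub_eq_iff_eq_add] at e₂
  have e₃ := d_comp_of_right (by lia : -2 + (i + 1 + 1) = i)
    (by lia : (-2 : ℤ) + 1 = -1) rfl t₁₂ hy₁
  have e₄ := T.d_comp (by lia : -1 + (i + 1) = i) (by lia : (-1 : ℤ) + 1 = 0) rfl rfl t₂₂ y₂
  rw [hy₂, map_neg, Int.negOnePow_neg, Int.negOnePow_one, Units.neg_smul, one_smul,
    neg_neg] at e₄
  rw [map_add, e₁, e₂, map_neg, map_neg, map_add, map_add, e₃, e₄]
  abel

end

/-- The element `(α, β)` of a cone represents the homotopy cofiber. -/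
theorem IsCone.represents {A B C : T.Obj} {f : (T.hom A B).X 0}
    (hf : (T.hom A B).dLin 0 1 f = 0) (h : T.IsCone f C) :
    (homotopyCofiber (representableMap f hf)).Represents C := by
  obtain ⟨γ, δ, α, β, ⟨hγ, hδ⟩, hαβ, ⟨t₁₁, t₁₂, t₂₁, t₂₂, ⟨h₁₁, h₁₂⟩, h₂₁, h₂₂⟩, s, hs⟩ := h
  refine ⟨_, (conePair_representableMap_closed hf).2 hαβ, fun x =>
    (quasiIso_iff_forall _).2 ⟨fun i u y hu hy => ?_, fun i y hy => ?_⟩⟩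
  · obtain ⟨y₁, y₂, rfl⟩ := exists_eq_conePair _ rfl y
    obtain ⟨hy₁, hy₂⟩ := (conePair_inj _ _).1
      ((conePair_representableMap_act hf (zero_add 1) rfl (zero_add (i + 1)) α β u).symm.trans
        (hy.trans (dLin_conePair_representableMap hf rfl rfl y₁ y₂)))
    exact exists_dLin_eq_of_cone hγ hδ hs hu hy₁ hy₂
  · obtain ⟨y₁, y₂, rfl⟩ := exists_eq_conePair _ rfl y
    obtain ⟨hy₁, hy₂⟩ := (conePair_eq_zero_iff _ _).1
      ((dLin_conePair_representableMap hf rfl rfl y₁ y₂).symm.trans hy)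
    replace hy₁ := neg_eq_zero.1 hy₁
    replace hy₂ := add_eq_zero_iff_eq_neg'.1 hy₂
    exact ⟨_, conePair _ rfl _ _, dLin_cone_eq_zero hγ hδ hy₁ hy₂,
      Eq.trans ((conePair_inj _ _).2 ⟨eq_comp_cone_fst h₁₁ h₂₁ hy₁ hy₂,
        eq_comp_cone_snd h₁₂ h₂₂ hy₁ hy₂⟩) ((congrArg₂ (· + ·)
        (conePair_representableMap_act hf (zero_add 1) rfl (zero_add (i + 1)) α β _)
        (dLin_conePair_representableMap hf rfl rfl _ _)).trans (conePair_add _ _ _ _ _ _)).symm⟩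

/-! If `(γ, δ)` is a right inverse of `(α, β)` up to the homotopy with entries `z₁', z₂', z₁, z₂`,
then `γ α + δ β - 1` is a cycle whose composition with `(α, β)` is a boundary. -/

section

variable {A B C : T.Obj} {f : (T.hom A B).X 0} {γ : (T.hom A C).X (-1)} {δ : (T.hom B C).X 0}
  {α : (T.hom C A).X 1} {β : (T.hom C B).X 0} {z₁ : (T.hom B A).X 0} {z₁' : (T.hom A A).X (-1)}
  {z₂ : (T.hom B B).X (-1)} {z₂' : (T.hom A B).X (-2)}

theorem dLin_coneRetraction
    (hγ : (T.hom A C).dLin (-1) 0 γ = T.comp (add_zero 0) δ f)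
    (hδ : (T.hom B C).dLin 0 1 δ = 0) (hα : (T.hom C A).dLin 1 2 α = 0)
    (hβ : (T.hom C B).dLin 0 1 β = -T.comp (zero_add 1) f α) :
    (T.hom C C).dLin 0 1
      (T.comp (by lia : (-1 : ℤ) + 1 = 0) γ α + T.comp (add_zero 0) δ β - T.one C) = 0 := by
  have e₁ := d_comp_of_right (by lia : (-1 : ℤ) + 1 = 0) (by lia : (-1 : ℤ) + 1 = 0)
    (zero_add 1) γ hα
  have e₂ := d_comp_of_left (add_zero 0) (zero_add 1) (zero_add 1) hδ β
  rw [hγ, T.assoc (add_zero 0) (zero_add 1)] at e₁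
  rw [hβ, map_neg, Int.negOnePow_zero, one_smul] at e₂
  rw [map_sub, map_add, e₁, e₂, T.d_one, sub_zero, add_neg_cancel]

theorem comp_coneRetraction_fst
    (hα : (T.hom C A).dLin 1 2 α = 0) (hβ : (T.hom C B).dLin 0 1 β = -T.comp (zero_add 1) f α)
    (hαγ : T.comp (by lia : (1 : ℤ) + -1 = 0) α γ =
      T.one A - T.comp (add_zero 0) z₁ f + (T.hom A A).dLin (-1) 0 z₁')
    (hαδ : T.comp (add_zero 1) α δ = (T.hom B A).dLin 0 1 z₁) :
    T.comp (add_zero 1) α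
      (T.comp (by lia : (-1 : ℤ) + 1 = 0) γ α + T.comp (add_zero 0) δ β - T.one C) =
    -(T.hom C A).dLin 0 1
      (-(T.comp (by lia : (-1 : ℤ) + 1 = 0) z₁' α + T.comp (add_zero 0) z₁ β)) := by
  have e₁ := congrArg (fun g => T.comp (zero_add 1) g α) hαγ
  simp only [comp_sub_left, comp_add_left, T.one_comp] at e₁
  rw [T.assoc (by lia : (1 : ℤ) + -1 = 0) (by lia : (-1 : ℤ) + 1 = 0),
    T.assoc (add_zero 0) (zero_add 1)] at e₁
  have e₂ := congrArg (fun g => T.comp (add_zero 1) g β) hαδ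
  replace e₂ : T.comp (add_zero 1) (T.comp (add_zero 1) α δ) β =
      T.comp (add_zero 1) ((T.hom B A).dLin 0 1 z₁) β := e₂
  rw [T.assoc (add_zero 1) (add_zero 0)] at e₂
  have e₃ := d_comp_of_right (by lia : (-1 : ℤ) + 1 = 0) (by lia : (-1 : ℤ) + 1 = 0)
    (zero_add 1) z₁' hα
  have e₄ := T.d_comp (add_zero 0) (zero_add 1) (zero_add 1) (zero_add 1) z₁ β
  rw [hβ, map_neg, Int.negOnePow_zero, one_smul] at e₄
  rw [map_sub, map_add, T.comp_one, e₁, e₂, map_neg, map_add, e₃, e₄]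
  abel

theorem comp_coneRetraction_snd
    (hα : (T.hom C A).dLin 1 2 α = 0) (hβ : (T.hom C B).dLin 0 1 β = -T.comp (zero_add 1) f α)
    (hβγ : T.comp (zero_add (-1)) β γ = -T.comp (add_zero (-1)) z₂ f -
      T.comp (zero_add (-1)) f z₁' - (T.hom A B).dLin (-2) (-1) z₂')
    (hβδ : T.comp (add_zero 0) β δ =
      T.one B - T.comp (add_zero 0) f z₁ - (T.hom B B).dLin (-1) 0 z₂) :
    T.comp (add_zero 0) β
      (T.comp (by lia : (-1 : ℤ) + 1 = 0) γ α + T.comp (add_zero 0) δ β - T.one C) =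
    T.comp (add_zero 0) f
      (-(T.comp (by lia : (-1 : ℤ) + 1 = 0) z₁' α + T.comp (add_zero 0) z₁ β)) +
    (T.hom C B).dLin (-1) 0
      (-(T.comp (by lia : (-2 : ℤ) + 1 = -1) z₂' α + T.comp (add_zero (-1)) z₂ β)) := by
  have e₁ := congrArg (fun g => T.comp (by lia : (-1 : ℤ) + 1 = 0) g α) hβγ
  simp only [comp_sub_left, comp_neg_left] at e₁
  rw [T.assoc (zero_add (-1)) (by lia : (-1 : ℤ) + 1 = 0),
    T.assoc (zero_add (-1)) (by lia : (-1 : ℤ) + 1 = 0),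
    T.assoc (add_zero (-1)) (zero_add 1)] at e₁
  have e₂ := congrArg (fun g => T.comp (add_zero 0) g β) hβδ
  simp only [comp_sub_left, T.one_comp] at e₂
  rw [T.assoc (add_zero 0) (add_zero 0), T.assoc (add_zero 0) (add_zero 0)] at e₂
  have e₃ := d_comp_of_right (by lia : (-2 : ℤ) + 1 = -1) (by lia : (-2 : ℤ) + 1 = -1)
    (by lia : (-1 : ℤ) + 1 = 0) z₂' hα
  have e₄ := T.d_comp (add_zero (-1)) (by lia : (-1 : ℤ) + 1 = 0) (zero_add 1)
    (by lia : (-1 : ℤ) + 1 = 0) z₂ β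
  rw [hβ, map_neg, Int.negOnePow_neg, Int.negOnePow_one, Units.neg_smul, one_smul,
    neg_neg] at e₄
  rw [map_sub, map_add, T.comp_one, e₁, e₂, map_neg, map_neg, map_add, map_add, e₃, e₄]
  abel

/-- Relative lifting along the quasi-isomorphism `T(x, C) ⟶ cone(T(x, A) ⟶ T(x, B))` given by
`(α, β)`. -/
theorem exists_lift_of_cone (hf : (T.hom A B).dLin 0 1 f = 0)
    {m : ((homotopyCofiber (representableMap f hf)).obj C).dLin 0 1
      (conePair (representableMap f hf) (zero_add 1) α β) = 0}
    (hm : ((homotopyCofiber (representableMap f hf)).yoneda _ m).IsWeakEquivalence)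
    {x : T.Obj} {h i j l : ℤ} (hhi : h + 1 = i) (hij : i + 1 = j) (hjl : j + 1 = l)
    {u : (T.hom x C).X j} {y₁ : (T.hom x A).X j} {y₂ : (T.hom x B).X i}
    (hu : (T.hom x C).dLin j l u = 0)
    (hy₁ : T.comp (by lia) α u = -(T.hom x A).dLin j l y₁)
    (hy₂ : T.comp (by lia) β u = T.comp (zero_add j) f y₁ + (T.hom x B).dLin i j y₂) :
    ∃ (u' : (T.hom x C).X i) (z₁ : (T.hom x A).X i) (z₂ : (T.hom x B).X h),
      (T.hom x C).dLin i j u' = u ∧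
      y₁ = T.comp (by lia) α u' - (T.hom x A).dLin i j z₁ ∧
      y₂ = T.comp (by lia) β u' + T.comp (zero_add i) f z₁ + (T.hom x B).dLin h i z₂ := by
  obtain ⟨u', z, hu', hz⟩ := exists_lift_of_quasiIso (hm x) hhi hij hjl hu
    (y := conePair _ hij y₁ y₂) (by
      refine (conePair_representableMap_act hf _ hjl _ α β u).trans
        (Eq.trans ?_ (dLin_conePair_representableMap hf hij hjl y₁ y₂).symm)
      rw [hy₁, hy₂])
  obtain ⟨z₁, z₂, rfl⟩ := exists_eq_conePair _ hhi z
  replace hz := hz.trans ((congrArg₂ (· + ·)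
    (conePair_representableMap_act hf (zero_add 1) hij (zero_add i) α β u')
    (dLin_conePair_representableMap hf hhi hij z₁ z₂)).trans (conePair_add _ _ _ _ _ _))
  obtain ⟨hz₁, hz₂⟩ := (conePair_inj _ _).1 hz
  exact ⟨u', z₁, z₂, hu', hz₁.trans (sub_eq_add_neg _ _).symm, hz₂.trans (add_assoc _ _ _).symm⟩

end

/-- If `(α, β)` represents the homotopy cofiber, then lifting along it the inclusion of `B` in
`cone(f)` gives `δ`, and lifting the inclusion of `A[1]`, relative to `δ ∘ f`, gives `γ`. This is a
right inverse up to homotopy; it is also a left inverse, by injectivity on cohomology. -/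
theorem Mod.Represents.isCone {A B C : T.Obj} {f : (T.hom A B).X 0}
    (hf : (T.hom A B).dLin 0 1 f = 0)
    (h : (homotopyCofiber (representableMap f hf)).Represents C) : T.IsCone f C := by
  obtain ⟨m, hm, h⟩ := h
  obtain ⟨(α : (T.hom C A).X 1), (β : (T.hom C B).X 0), rfl⟩ := exists_eq_conePair _ (zero_add 1) m
  obtain ⟨hα, hβ⟩ := (conePair_representableMap_closed hf).1 hm
  -- `(0, 1)` is the inclusion of `B` in the cone of `f`
  obtain ⟨δ, z₁, z₂, hδ, hz₁, hz₂⟩ := exists_lift_of_cone hf h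
    (by lia : (-1 : ℤ) + 1 = 0) (zero_add 1) (by lia : (1 : ℤ) + 1 = 2)
    (u := (0 : (T.hom B C).X 1)) (y₁ := 0) (y₂ := T.one B) (map_zero _)
    (by rw [comp_zero_right, map_zero, neg_zero])
    (by rw [comp_zero_right, comp_zero_right, T.d_one, add_zero])
  have hβδ : T.comp (add_zero 0) β δ =
      T.one B - T.comp (add_zero 0) f z₁ - (T.hom B B).dLin (-1) 0 z₂ := by
    rw [hz₂]
    abel
  have hαδ : T.comp (add_zero 1) α δ = (T.hom B A).dLin 0 1 z₁ := (sub_eq_zero.1 hz₁.symm)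
  -- `(1, 0)` is the inclusion of `A[1]`, corrected by the homotopy chosen for `δ`
  obtain ⟨γ, z₁', z₂', hγ, h₁, h₂⟩ := exists_lift_of_cone hf h
    (by lia : (-2 : ℤ) + 1 = -1) (by lia : (-1 : ℤ) + 1 = 0) (zero_add 1)
    (u := T.comp (add_zero 0) δ f) (y₁ := T.one A - T.comp (add_zero 0) z₁ f)
    (y₂ := -T.comp (add_zero (-1)) z₂ f)
    (by rw [d_comp_of_right _ (zero_add 1) _ _ hf, hδ, comp_zero_left]; lia)
    (by
      rw [← T.assoc (add_zero 1) (add_zero 0) (add_zero 1), hαδ, map_sub, T.d_one, zero_sub,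
        neg_neg, d_comp_of_right _ (zero_add 1) _ _ hf]
      lia)
    (by
      rw [← T.assoc (add_zero 0) (add_zero 0) (add_zero 0), hβδ, comp_sub_left, comp_sub_left,
        T.one_comp, map_sub, T.comp_one, T.assoc (add_zero 0) (add_zero 0) (add_zero 0), map_neg,
        d_comp_of_right _ (by lia : (-1 : ℤ) + 1 = 0) _ _ hf, sub_eq_add_neg _
          (T.comp _ ((T.hom B B).dLin (-1) 0 z₂) f)]
      lia)
  have hαγ : T.comp (by lia : (1 : ℤ) + -1 = 0) α γ =
      T.one A - T.comp (add_zero 0) z₁ f + (T.hom A A).dLin (-1) 0 z₁' := by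
    rw [h₁, sub_add_cancel]
  have hβγ : T.comp (zero_add (-1)) β γ = -T.comp (add_zero (-1)) z₂ f -
      T.comp (zero_add (-1)) f z₁' - (T.hom A B).dLin (-2) (-1) z₂' := by
    rw [h₂]
    abel
  refine ⟨γ, δ, α, β, ⟨hγ, hδ⟩, ⟨hα, hβ⟩, ⟨-z₁', -z₂', -z₁, -z₂, ⟨?_, ?_⟩, ?_, ?_⟩, ?_⟩
  · rw [hαγ, map_neg, neg_neg, comp_neg_left]
    abel
  · rw [hβγ, map_neg, map_neg, comp_neg_left]
    abel
  · rw [hαδ, map_neg, neg_neg]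
  · rw [hβδ, map_neg, map_neg]
    abel
  · obtain ⟨s, -, -, hs, -, -⟩ := exists_lift_of_cone hf h (by lia : (-2 : ℤ) + 1 = -1)
      (by lia : (-1 : ℤ) + 1 = 0) (zero_add 1) (dLin_coneRetraction hγ hδ hα hβ)
      (comp_coneRetraction_fst hα hβ hαγ hαδ) (comp_coneRetraction_snd hα hβ hβγ hβδ)
    exact ⟨s, hs.symm⟩

/-! ### Comparison of the two definitions -/

/-- If the element `m` of `(ΣM)(c)` represents `ΣM`, and `a : c' ⟶ c` is a closed morphism of degree
`-1` which is invertible up to homotopy, then `m · a` represents `M`. -/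
theorem Mod.Represents.of_suspension {M : T.Mod} {c c' : T.Obj} (hM : M.suspension.Represents c)
    (hc : T.IsShift c c' (-1)) : M.Represents c' := by
  obtain ⟨(m : (M.obj c).X 1), hm, h⟩ := hM
  have hm' : (M.obj c).dLin 1 2 m = 0 := neg_eq_zero.1 ((suspension_dLin M c 0 1 m).symm.trans hm)
  obtain ⟨a, b, ha, hb, ⟨s, hs⟩, ⟨t, ht⟩⟩ := (isShift_iff rfl (by lia : (-1 : ℤ) + 1 = 0)
    (by lia : (1 : ℤ) + -1 = 0) (by lia : (-1 : ℤ) + 1 = 0) (by lia : (1 : ℤ) + 1 = 2) rfl rfl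
    (by lia : (-1 : ℤ) + 1 = 0) (by lia : (-1 : ℤ) + 1 = 0)).1 hc
  replace hs : T.comp (by lia : (-1 : ℤ) + 1 = 0) a b - T.one c = (T.hom c c).dLin (-1) 0 s := hs
  replace ht : T.comp (by lia : (1 : ℤ) + -1 = 0) b a - T.one c' = (T.hom c' c').dLin (-1) 0 t := ht
  have he : (M.obj c').dLin 0 1 (M.act (by lia : (1 : ℤ) + -1 = 0) m a) = 0 := by
    rw [M.d_act_of_left _ (by lia : (-1 : ℤ) + 1 = 0) _ hm', ha, map_zero, smul_zero]
    lia
  refine ⟨_, he, fun x => (quasiIso_iff_forall _).2 ⟨fun i (u : (T.hom x c').X (i + 1)) y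
    (hu : (T.hom x c').dLin (i + 1) (i + 1 + 1) u = 0) hy => ?_, fun i y hy => ?_⟩⟩
  · -- the index is written as a successor to view `y` as an element of the suspension
    obtain ⟨n, rfl⟩ : ∃ n, i = n + 1 := ⟨i - 1, by lia⟩
    replace hy : M.act (zero_add (n + 1 + 1)) (M.act (by lia : (1 : ℤ) + -1 = 0) m a) u =
      (M.obj x).dLin (n + 1) (n + 1 + 1) y := hy
    rw [M.act_act _ (by lia : -1 + (n + 1 + 1) = n + 1)] at hy
    have hau : (T.hom x c).dLin (n + 1) (n + 1 + 1)
        (T.comp (by lia : -1 + (n + 1 + 1) = n + 1) a u) = 0 := by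
      rw [d_comp_of_left _ (by lia : n + 1 + 1 + 1 = n + 1 + 1 + 1) _ ha, hu, map_zero, smul_zero]
      lia
    obtain ⟨(v : (T.hom x c).X n), hv⟩ := exists_dLin_eq_of_quasiIso (h x) rfl rfl hau
      (y := (-y : (M.obj x).X (n + 1)))
      (hy.trans ((suspension_dLin M x n (n + 1) (-y)).trans
        ((congrArg Neg.neg (map_neg _ _)).trans (neg_neg _))).symm)
    replace hv : (T.hom x c).dLin n (n + 1) v = T.comp (by lia) a u := hv
    have e₁ := d_comp_of_left (by lia : 1 + n = n + 1) rfl rfl hb v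
    rw [hv, ← T.assoc (by lia : (1 : ℤ) + -1 = 0) _ (zero_add (n + 1 + 1)),
      eq_add_of_sub_eq' ht, comp_add_left, T.one_comp, Int.negOnePow_one, Units.neg_smul,
      one_smul] at e₁
    have e₂ := d_comp_of_right (by lia : -1 + (n + 1 + 1) = n + 1) (by lia : (-1 : ℤ) + 1 = 0)
      rfl t hu
    refine ⟨(-T.comp (by lia : 1 + n = n + 1) b v - T.comp (by lia) t u :
      (T.hom x c').X (n + 1)), ?_⟩
    change (T.hom x c').dLin (n + 1) (n + 1 + 1) (-_ - _) = u
    rw [map_sub, map_neg, e₁, e₂]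
    abel
  · obtain ⟨n, rfl⟩ : ∃ n, i = n + 1 := ⟨i - 1, by lia⟩
    obtain ⟨(v : (T.hom x c).X (n + 1)), (w : (M.obj x).X (n + 1)), hv, hw⟩ :=
      exists_eq_add_dLin_of_quasiIso (h x) rfl rfl (y := (y : (M.obj x).X (n + 1 + 1)))
        ((suspension_dLin M x (n + 1) (n + 1 + 1) y).trans (neg_eq_zero.2 hy))
    replace hv : (T.hom x c).dLin (n + 1) (n + 1 + 1) v = 0 := hv
    replace hw : y = M.act (by lia : 1 + (n + 1) = n + 1 + 1) m v +
        -(M.obj x).dLin (n + 1) (n + 1 + 1) w :=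
      hw.trans (congrArg (fun z => _ + z) (suspension_dLin M x n (n + 1) w))
    refine ⟨(T.comp (by lia : 1 + (n + 1) = n + 1 + 1) b v : (T.hom x c').X (n + 1 + 1)),
      M.act (by lia : 1 + n = n + 1) m (T.comp (by lia : -1 + (n + 1) = n) s v) - w, ?_, ?_⟩
    · refine (d_comp_of_left _ (by lia : n + 1 + 1 = n + 1 + 1) rfl hb v).trans ?_
      rw [hv, map_zero, smul_zero]
      rfl
    · have e₁ := d_comp_of_right (by lia : -1 + (n + 1) = n) (by lia : (-1 : ℤ) + 1 = 0) rfl s hv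
      have e₂ := M.d_act_of_left (by lia : 1 + n = n + 1) rfl rfl hm'
        (T.comp (by lia : -1 + (n + 1) = n) s v)
      rw [e₁, ← hs, comp_sub_left, T.one_comp, map_sub, Int.negOnePow_one, Units.neg_smul,
        one_smul, T.assoc (by lia : (-1 : ℤ) + 1 = 0) (by lia : 1 + (n + 1) = n + 1 + 1),
        ← M.act_act (by lia : (1 : ℤ) + -1 = 0) _ (zero_add (n + 1 + 1))] at e₂
      have e : y = M.act (zero_add (n + 1 + 1)) (M.act (by lia : (1 : ℤ) + -1 = 0) m a)
          (T.comp (by lia : 1 + (n + 1) = n + 1 + 1) b v) + (M.obj x).dLin (n + 1) (n + 1 + 1)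
            (M.act (by lia : 1 + n = n + 1) m (T.comp (by lia : -1 + (n + 1) = n) s v) - w) := by
        rw [map_sub, e₂, hw]
        abel
      exact e

/-- A map `φ : M ⟶ N` of modules represented by `a` and `b` comes, up to a homotopy, from a closed
morphism `f : a ⟶ b`, and a cone of `f` represents the homotopy cofiber of `φ`. -/
theorem Mod.exists_represents_homotopyCofiber {M N : T.Mod} {a b : T.Obj} (hM : M.Represents a)
    (hN : N.Represents b)
    (hT : ∀ f : (T.hom a b).X 0, (T.hom a b).dLin 0 1 f = 0 → ∃ C, T.IsCone f C)
    (φ : Hom M N) : ∃ C, (homotopyCofiber φ).Represents C := by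
  obtain ⟨m, hm, hM⟩ := hM
  obtain ⟨n, hn, hN⟩ := hN
  obtain ⟨(f : (T.hom a b).X 0), σ, (hf : (T.hom a b).dLin 0 1 f = 0), hσ⟩ :=
    exists_eq_add_dLin_of_quasiIso (hN a) (by lia : (-1 : ℤ) + 1 = 0) (zero_add 1)
      (y := ((φ.app a).f 0).hom m) (by rw [dLin_hom, hm, map_zero])
  obtain ⟨C, hC⟩ := hT f hf
  refine ⟨C, .of_hom (cofiberMap (φ' := representableMap f hf) (m := yoneda M m hm)
    (n := yoneda N n hn) ?_) (cofiberMap_isWeakEquivalence _ hM hN) (hC.represents hf)⟩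
  exact
    { s x p q h := -N.act (by lia : -1 + q = p) σ
      comm x p q r hpq hqr (u : (T.hom x a).X q) := by
        have e₁ := N.d_act (by lia : -1 + q = p) (by lia : (-1 : ℤ) + 1 = 0) hqr hpq σ u
        have e₂ : ((φ.app x).f q).hom (M.act (zero_add q) m u) =
            N.act (zero_add q) n (T.comp (zero_add q) f u) +
              N.act (zero_add q) ((N.obj a).dLin (-1) 0 σ) u := by
          rw [φ.app_act, hσ, map_add, LinearMap.add_apply]
          exact congrArg (· + _) (N.act_act _ _ _ n f u)
        have e₃ : N.act (zero_add q) n (T.comp (zero_add q) f u) =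
            ((φ.app x).f q).hom (M.act (zero_add q) m u) +
              (N.obj x).dLin p q (-N.act (by lia : -1 + q = p) σ u) +
                -N.act (by lia : -1 + r = q) σ ((T.hom x a).dLin q r u) := by
          rw [map_neg, e₁, e₂, Int.negOnePow_neg, Int.negOnePow_one, Units.neg_smul, one_smul]
          abel
        exact e₃
      s_act {x y p q p' q' r} hpq hp hq u g := by
        exact (congrArg Neg.neg (N.act_act (by lia) hq hp σ u g).symm).trans
          (LinearMap.congr_fun (map_neg (N.act hp) _) g).symm }

theorem isPretriangulated_of_isPretriangulatedBK (h : T.IsPretriangulatedBK) :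
    T.IsPretriangulated := by
  obtain ⟨⟨z, hz⟩, hshift, hcone⟩ := isPretriangulatedBK_iff.1 h
  refine ⟨⟨z, .symm _ _ ?_⟩, fun M hM => ?_, fun M N hM hN φ => ?_⟩
  · exact (weaklyEquivalent_representable_iff _ _).2 (represents_zero_iff.2 hz)
  · rw [weaklyRepresentable_iff] at hM ⊢
    obtain ⟨c, hc⟩ := hM
    exact (hshift c (-1)).imp fun c' => hc.of_suspension
  · rw [weaklyRepresentable_iff] at hM hN ⊢
    obtain ⟨a, ha⟩ := hM
    obtain ⟨b, hb⟩ := hN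
    exact exists_represents_homotopyCofiber ha hb (hcone a b) φ

theorem isPretriangulatedBK_of_isPretriangulated (h : T.IsPretriangulated) :
    T.IsPretriangulatedBK := by
  obtain ⟨⟨z, hz⟩, hdesusp, hcone⟩ := h
  have hrep (A : T.Obj) : (representable T A).WeaklyRepresentable := ⟨A, .refl _⟩
  have hzero : (zero T).WeaklyRepresentable := ⟨z, .symm _ _ hz⟩
  refine isPretriangulatedBK_iff.2 ⟨⟨z, ?_⟩, ?_, fun A B f hf => ?_⟩
  · exact represents_zero_iff.1 ((weaklyEquivalent_representable_iff _ _).1 (.symm _ _ hz))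
  · refine exists_isShift_of_one_of_neg_one (fun A => ?_) fun A => ?_
    · obtain ⟨B, hB⟩ := (weaklyRepresentable_iff _).1
        (hcone _ _ (hrep A) hzero (toZero (representable T A)))
      exact ⟨B, (hB.of_hom _ (cofiberToSuspension_isWeakEquivalence _)).isShift_one⟩
    · obtain ⟨B, hB⟩ := (weaklyRepresentable_iff _).1 (hdesusp (representable T A).desuspension
        ((weaklyRepresentable_iff _).2 ⟨A, represents_suspension_desuspension A⟩))
      exact ⟨B, hB.isShift_neg_one⟩
  · obtain ⟨C, hC⟩ := (weaklyRepresentable_iff _).1 (hcone _ _ (hrep A) (hrep B)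
      (representableMap f hf))
    exact ⟨C, hC.isCone hf⟩

end DGCategory

/-- The module-theoretic definition of a pretriangulated dg category agrees with that of Bondal and
Kapranov. -/
theorem mainTheorem6 {k : Type w} [Field k] [CharZero k] (T : DGCategory.{u, v, w} k) :
    T.IsPretriangulated ↔ T.IsPretriangulatedBK :=
  ⟨DGCategory.isPretriangulatedBK_of_isPretriangulated,
    DGCategory.isPretriangulated_of_isPretriangulatedBK⟩
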